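/- **Setting.** Let $n\ge 1$, let $A\in\mathbb R^{m\times n}$ have rank $m$, let $W=\ker(A)\subseteq\mathbb R^n$, $\beta\in(0,1/4]$ and $\gamma=\beta/(2^{10}n^5)$. For $\delta\in\mathbb R^n_{++}$ let $\mathrm{Diag}(\delta)W=\{(\delta_ix_i)_{i}:x\in W\}$. A *circuit* of a subspace $U\subseteq\mathbb R^n$ is an inclusion-wise minimal support $C$ of a nonzero vector of $U$; the vector $g^C\in U$ with support $C$ is unique up to scaling. Let $\kappa^U_{ij}$ be the maximum of $|g^C_j/g^C_i|$ over the circuits $C$ of $U$ containing $i$ and $j$ (and $0$ if there are none), $\kappa_{ij}=\kappa_{ij}^W$ and $\kappa^\delta_{ij}=\kappa^{\mathrm{Diag}(\delta)W}_{ij}$. For $\sigma>0$ let $G_{\delta,\sigma}$ be the digraph on $[n]$ with edges $(i,j)$ such that $\kappa^\delta_{ij}\ge\sigma$. For $I\subseteq[n]$, let $\pi_I$ be the projection onto the coordinates in $I$ and let $L^U_I:\pi_I(U)\to U$ send $p$ to the vector of minimum Euclidean norm among the $z\in U$ with $z_I=p$. The lifting score is $\ell^U(I)=\sqrt{\|L^U_I\|^2-1}$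 (operator norm; $0$ if $\pi_I(U)=\{0\}$). A *layering* is an ordered partition $\mathcal J=(J_1,\dots,J_p)$ of $[n]$ into nonempty layers, $J_{\ge k}=J_k\cup\dots\cup J_p$, and $\ell^\delta(\mathcal J)=\max_{2\le k\le p}\ell^{\mathrm{Diag}(\delta)W}(J_{\ge k})$ ($0$ if $p=1$). The layering is *$\delta$-balanced* if $\ell^\delta(\mathcal J)\le\gamma$ and every $J_k$ is strongly connected in $G_{\delta,\gamma/n}$. The *estimates* $\hat\kappa=(\hat\kappa_{ij})_{i\ne j}$ satisfy, for all $i\neq j$: $\hat\kappa_{ij}\le\kappa_{ij}$, and there is a circuit $C\ni i,j$ with $|g^C_j/g^C_i|\le\hat\kappa_{ij}$ and $|g^C_i/g^C_j|\le\hat\kappa_{ji}$ (so any two distinct indices lie in a common circuit). Let $\hat G_{\delta,\sigma}$ be the digraph on $[n]$ with edges $(i,j)$, $i\ne j$, such that $\hat\kappa_{ij}\delta_j/\delta_i\ge\sigma$. **Layering$(\delta,\hat\kappa)$.** 1. Compute the strongly connected components $C_1,\dots,C_\ell$ of $\hat G_{\delta,\gamma/n}$, ordered so that $(u,v)$ is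 an edge of it whenever $u\in C_a$, $v\in C_b$, $a<b$. Let $\bar E$ be the edge set of $\hat G_{\delta,\gamma/n}$. 2. For $k=2,\dots,\ell$, call Verify-Lift$(\mathrm{Diag}(\delta)W,C_{\ge k},\gamma)$. It answers 'pass', which it may do only if $\ell^{\mathrm{Diag}(\delta)W}(C_{\ge k})\le\gamma$, or 'fail' with $i\in C_{\ge k}$, $j\in C_{<k}$ and $t$ such that $\gamma/n\le t\le\kappa^\delta_{ij}$. If it fails, set $\hat\kappa_{ij}\leftarrow t\,\delta_i/\delta_j$ and add $(i,j)$ to $\bar E$. 3. Return the strongly connected components $J_1,\dots,J_p$ of $([n],\bar E)$, ordered so that all pairs from an earlier to a later component are edges of the initial $\hat G_{\delta,\gamma/n}$ (that of step 1), and the updated $\hat\kappa$. **Lemma.** The subroutine Layering$(\delta,\hat\kappa)$ returns a $\delta$-balanced layering, and it can be implemented, with all calls of Verify-Lift included, in $O(nm^2+n^2)$ time. More precisely: there are a single program for the unit-cost real RAM (exact arithmetic and comparisons on real numbers, index arithmetic, and indirect addressing, each at cost one) and an absolute constant $K$ such that for all $m,n,A,\beta,\delta,\hat\kappa$ as above,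 every output of Layering$(\delta,\hat\kappa)$, whatever the valid answers of Verify-Lift are, is a $\delta$-balanced layering; and the program, on input $(m,n,A,\beta,\delta,\hat\kappa)$, halts after at most $K(nm^2+n^2)$ steps with a pair $(\mathcal J,\hat\kappa')$ that is an output of Layering$(\delta,\hat\kappa)$, so that $\mathcal J$ is $\delta$-balanced. -/

import Mathlib

noncomputable section

namespace LayeredLS

/-! ### Subspaces, circuits and circuit imbalances -/

/-- `ℝⁿ` with the Euclidean norm. -/
abbrev Vec (n : ℕ) : Type := EuclideanSpace ℝ (Fin n)

/-- The support of a vector. -/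
def supp {n : ℕ} (x : Vec n) : Set (Fin n) := {i | x i ≠ 0}

/-- The subspace `W = ker A`. -/
def kerSpace {m n : ℕ} (A : Matrix (Fin m) (Fin n) ℝ) : Submodule ℝ (Vec n) :=
  LinearMap.ker (Matrix.toEuclideanLin A)

/-- The linear map `x ↦ (δ₁x₁, …, δₙxₙ)`. -/
def diagMap {n : ℕ} (δ : Fin n → ℝ) : Vec n →ₗ[ℝ] Vec n where
  toFun x := WithLp.toLp 2 (fun i => δ i * x i)
  map_add' x y := by ext i; simp [mul_add]
  map_smul' c x := by ext i; simp [mul_left_comm]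

/-- The rescaled subspace `Diag(δ) W`. -/
def rescale {n : ℕ} (δ : Fin n → ℝ) (W : Submodule ℝ (Vec n)) : Submodule ℝ (Vec n) :=
  W.map (diagMap δ)

/-- `g` is an elementary vector `g^C` of `W`: a nonzero vector of `W` whose support is
inclusion-wise minimal among the supports of the nonzero vectors of `W`. -/
def IsElementary {n : ℕ} (W : Submodule ℝ (Vec n)) (g : Vec n) : Prop :=
  g ∈ W ∧ g ≠ 0 ∧ ∀ h ∈ W, h ≠ 0 → supp h ⊆ supp g → supp h = supp g

/-- `C` is a circuit of `W`, the support of an elementary vector (for `W = ker A`: a minimal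
linearly dependent set of columns of `A`). -/
def IsCircuit {n : ℕ} (W : Submodule ℝ (Vec n)) (C : Set (Fin n)) : Prop :=
  ∃ g, IsElementary W g ∧ supp g = C

/-- The circuit imbalance `κ_{ij}^W`: the maximum of `|g_j / g_i|` over the circuits `C`
containing `i` and `j`, where `g ∈ W` has support `C`; it is `0` if there is no such circuit.
(There are finitely many circuits, and `g` is unique up to scaling, so the supremum is over a
finite set.) -/
def kappa {n : ℕ} (W : Submodule ℝ (Vec n)) (i j : Fin n) : ℝ :=
  sSup {r : ℝ | ∃ C : Set (Fin n), IsCircuit W C ∧ i ∈ C ∧ j ∈ C ∧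
    ∃ g ∈ W, supp g = C ∧ r = |g j / g i|}

/-! ### Lifting maps and lifting scores -/

/-- The coordinate projection `π_I : ℝⁿ → ℝ^I`. -/
def coordProj {n : ℕ} (I : Finset (Fin n)) : Vec n →ₗ[ℝ] EuclideanSpace ℝ I where
  toFun x := WithLp.toLp 2 (fun i => x i.1)
  map_add' x y := by ext i; simp
  map_smul' c x := by ext i; simp

/-- The coordinate projection `W → π_I(W)`. -/
def projOn {n : ℕ} (W : Submodule ℝ (Vec n)) (I : Finset (Fin n)) :
    W →ₗ[ℝ] W.map (coordProj I) :=
  (coordProj I).submoduleMap W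

/-- The orthogonal complement, inside `W`, of the vectors of `W` that vanish on `I`. -/
def liftRange {n : ℕ} (W : Submodule ℝ (Vec n)) (I : Finset (Fin n)) : Submodule ℝ W :=
  (LinearMap.ker (projOn W I))ᗮ

theorem projOn_bijective {n : ℕ} (W : Submodule ℝ (Vec n)) (I : Finset (Fin n)) :
    Function.Bijective ((projOn W I).domRestrict (liftRange W I)) := by
  constructor
  · rw [← LinearMap.ker_eq_bot, LinearMap.ker_eq_bot']
    rintro ⟨x, hx⟩ h
    have h1 : x ∈ LinearMap.ker (projOn W I) := h
    have h2 := (Submodule.mem_orthogonal _ _).1 hx x h1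
    exact Subtype.ext (inner_self_eq_zero.1 h2)
  · intro y
    obtain ⟨w, rfl⟩ := (coordProj I).submoduleMap_surjective W y
    obtain ⟨k, hk, l, hl, rfl⟩ :=
      (LinearMap.ker (projOn W I)).exists_add_mem_mem_orthogonal w
    refine ⟨⟨l, hl⟩, ?_⟩
    have h1 : projOn W I k = 0 := hk
    change projOn W I l = projOn W I (k + l)
    rw [map_add, h1, zero_add]

/-- The lifting map `L_I^W : π_I(W) → W`, sending `p` to the vector of minimum Euclidean norm among
the `z ∈ W` with `z_I = p` (see `liftMap_proj` and `liftMap_min`). -/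
def liftMap {n : ℕ} (W : Submodule ℝ (Vec n)) (I : Finset (Fin n)) :
    W.map (coordProj I) →ₗ[ℝ] W :=
  (liftRange W I).subtype ∘ₗ
    (LinearEquiv.ofBijective _ (projOn_bijective W I)).symm.toLinearMap

theorem projOn_liftMap {n : ℕ} (W : Submodule ℝ (Vec n)) (I : Finset (Fin n))
    (p : W.map (coordProj I)) : projOn W I (liftMap W I p) = p :=
  (LinearEquiv.ofBijective _ (projOn_bijective W I)).apply_symm_apply p

theorem liftMap_proj {n : ℕ} (W : Submodule ℝ (Vec n)) (I : Finset (Fin n))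
    (p : W.map (coordProj I)) : coordProj I (liftMap W I p : Vec n) = p :=
  congrArg Subtype.val (projOn_liftMap W I p)

theorem liftMap_min {n : ℕ} (W : Submodule ℝ (Vec n)) (I : Finset (Fin n))
    (p : W.map (coordProj I)) (z : W) (hz : coordProj I (z : Vec n) = p) :
    ‖liftMap W I p‖ ≤ ‖z‖ := by
  have hz' : projOn W I z = p := Subtype.ext hz
  have hk : z - liftMap W I p ∈ LinearMap.ker (projOn W I) := by
    rw [LinearMap.mem_ker, map_sub, hz', projOn_liftMap, sub_self]
  have hl : liftMap W I p ∈ liftRange W I := Subtype.property _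
  have h0 := (Submodule.mem_orthogonal _ _).1 hl _ hk
  have h1 := norm_add_sq_eq_norm_sq_add_norm_sq_of_inner_eq_zero _ _ h0
  rw [sub_add_cancel] at h1
  nlinarith [norm_nonneg z, norm_nonneg (liftMap W I p), norm_nonneg (z - liftMap W I p)]

/-- The operator norm `‖L_I^W‖` with respect to the Euclidean norms. -/
def liftNorm {n : ℕ} (W : Submodule ℝ (Vec n)) (I : Finset (Fin n)) : ℝ :=
  ‖LinearMap.toContinuousLinearMap (liftMap W I)‖

/-- The lifting score `ℓ^W(I) = √(‖L_I^W‖² - 1)`.  Here `‖L_I^W‖ ≥ 1` unless `π_I(W) = {0}`, where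
the value is `0`. -/
def liftScore {n : ℕ} (W : Submodule ℝ (Vec n)) (I : Finset (Fin n)) : ℝ :=
  Real.sqrt (liftNorm W I ^ 2 - 1)

/-! ### Layerings -/

/-- A layering (ordered partition) of `[n]` into `p` nonempty layers.  The layers are numbered from
`0` to `p - 1`, and `layer i` is the number of the layer that contains `i`. -/
structure Layering (n : ℕ) where
  p : ℕ
  layer : Fin n → Fin p
  surj : Function.Surjective layer

/-- The layer with number `k`. -/
def Layering.part {n : ℕ} (J : Layering n) (k : Fin J.p) : Finset (Fin n) :=
  Finset.univ.filter (fun i => J.layer i = k)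

/-- The union of the layers with numbers at least `k`. -/
def Layering.upper {n : ℕ} (J : Layering n) (k : ℕ) : Finset (Fin n) :=
  Finset.univ.filter (fun i => k ≤ (J.layer i : ℕ))

/-- The lifting score of a layering: the maximum of the lifting scores of the sets `J_{≥ k}` over
all layers `k` except the first one (`0` if there is a single layer). -/
def layeringScore {n : ℕ} (W : Submodule ℝ (Vec n)) (J : Layering n) : ℝ :=
  ⨆ k : {k : Fin J.p // 0 < (k : ℕ)}, liftScore W (J.upper k.1)

/-- The threshold `γ = β / (2¹⁰ n⁵)`. -/
def gam (n : ℕ) (β : ℝ) : ℝ := β / (2 ^ 10 * (n : ℝ) ^ 5)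

/-- The edge relation of `G_{δ,σ}`: `(i, j)` is an edge if `κ_{ij}^δ ≥ σ`. -/
def auxGraph {n : ℕ} (W : Submodule ℝ (Vec n)) (δ : Fin n → ℝ) (σ : ℝ) (i j : Fin n) : Prop :=
  σ ≤ kappa (rescale δ W) i j

/-- The vertex set `S` is strongly connected in the digraph `E`: any vertex of `S` is reachable from
any other along edges of `E` inside `S`. -/
def StronglyConnectedIn {n : ℕ} (E : Fin n → Fin n → Prop) (S : Finset (Fin n)) : Prop :=
  ∀ i ∈ S, ∀ j ∈ S, Relation.ReflTransGen (fun a b => a ∈ S ∧ b ∈ S ∧ E a b) i j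

/-- `J` is `δ`-balanced. -/
def IsBalanced {n : ℕ} (W : Submodule ℝ (Vec n)) (β : ℝ) (δ : Fin n → ℝ) (J : Layering n) : Prop :=
  layeringScore (rescale δ W) J ≤ gam n β ∧
    ∀ k : Fin J.p, StronglyConnectedIn (auxGraph W δ (gam n β / n)) (J.part k)

/-! ### The subroutine Layering -/

/-- The estimates `κ̂` kept by the algorithm: every pair `i ≠ j` has a circuit through it whose
imbalances are taken into account in `κ̂_{ij}` and `κ̂_{ji}` (they are found at initialization, and
the estimates never decrease later), and `κ̂` stays a lower bound on `κ`.  The diagonal entries play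
no role. -/
def IsEstimate {n : ℕ} (W : Submodule ℝ (Vec n)) (κh : Fin n → Fin n → ℝ) : Prop :=
  ∀ i j : Fin n, i ≠ j → κh i j ≤ kappa W i j ∧
    ∃ g, IsElementary W g ∧ g i ≠ 0 ∧ g j ≠ 0 ∧ |g j / g i| ≤ κh i j ∧ |g i / g j| ≤ κh j i

/-- The edge relation of `Ĝ_{δ,σ}`: `(i, j)`, `i ≠ j`, is an edge if
`κ̂_{ij}^δ = κ̂_{ij} δ_j / δ_i ≥ σ`. -/
def estGraph {n : ℕ} (κh : Fin n → Fin n → ℝ) (δ : Fin n → ℝ) (σ : ℝ) (i j : Fin n) : Prop :=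
  i ≠ j ∧ σ ≤ κh i j * δ j / δ i

/-- The layers of `C` are the strongly connected components of the digraph `E`, listed in the
ordering imposed by the digraph `F`: all pairs from an earlier to a later layer are edges of `F`. -/
def IsSCCListing {n : ℕ} (E F : Fin n → Fin n → Prop) (C : Layering n) : Prop :=
  (∀ i j, C.layer i = C.layer j ↔ Relation.ReflTransGen E i j ∧ Relation.ReflTransGen E j i) ∧
    ∀ i j, C.layer i < C.layer j → F i j

/-- The answers of Verify-Lift: `pass`, or `fail` with a certificate `i, j, t`. -/
inductive Answer (n : ℕ) where
  | pass : Answer n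
  | fail (i j : Fin n) (t : ℝ) : Answer n

/-- The answers that a call of Verify-Lift`(U, I, θ)` may give. -/
def VerifyLift {n : ℕ} (U : Submodule ℝ (Vec n)) (I : Finset (Fin n)) (θ : ℝ) : Answer n → Prop
  | .pass => liftScore U I ≤ θ
  | .fail i j t => i ∈ I ∧ j ∉ I ∧ θ / n ≤ t ∧ t ≤ kappa U i j

/-- `LoopState W β δ κ̂ C k κ' E` says that the values of `κ̂` and of the edge set may be `κ'` and `E`
when the main loop of Layering has treated the candidate layers with numbers `1, …, k - 1` of `C`
(all layers but the first one are treated, in this order). -/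
inductive LoopState {n : ℕ} (W : Submodule ℝ (Vec n)) (β : ℝ) (δ : Fin n → ℝ)
    (κh : Fin n → Fin n → ℝ) (C : Layering n) :
    ℕ → (Fin n → Fin n → ℝ) → (Fin n → Fin n → Prop) → Prop
  | start : LoopState W β δ κh C 1 κh (estGraph κh δ (gam n β / n))
  | pass (k : ℕ) (κ' : Fin n → Fin n → ℝ) (E : Fin n → Fin n → Prop) :
      LoopState W β δ κh C k κ' E → k < C.p →
      VerifyLift (rescale δ W) (C.upper k) (gam n β) .pass →
      LoopState W β δ κh C (k + 1) κ' E
  | fail (k : ℕ) (κ' : Fin n → Fin n → ℝ) (E : Fin n → Fin n → Prop) (i j : Fin n) (t : ℝ) :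
      LoopState W β δ κh C k κ' E → k < C.p →
      VerifyLift (rescale δ W) (C.upper k) (gam n β) (.fail i j t) →
      LoopState W β δ κh C (k + 1)
        (fun a b => if a = i ∧ b = j then t * δ i / δ j else κ' a b)
        (fun a b => E a b ∨ (a = i ∧ b = j))

/-- `(J, κ')` is a possible output of Layering`(δ, κ̂)`. -/
def LayeringReturns {n : ℕ} (W : Submodule ℝ (Vec n)) (β : ℝ) (δ : Fin n → ℝ)
    (κh : Fin n → Fin n → ℝ) (J : Layering n) (κ' : Fin n → Fin n → ℝ) : Prop :=
  ∃ (C : Layering n) (E : Fin n → Fin n → Prop),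
    IsSCCListing (estGraph κh δ (gam n β / n)) (estGraph κh δ (gam n β / n)) C ∧
    LoopState W β δ κh C C.p κ' E ∧
    IsSCCListing E (estGraph κh δ (gam n β / n)) J

end LayeredLS

/-! ### The machine model: a unit-cost real RAM

Programs are while-programs over registers and two-dimensional arrays, of natural numbers (used for
indices) and of real numbers.  Reals support exact `+, -, *, /` and comparison, natural numbers
support `+`, truncated `-` and comparison; there is no rounding and no passage from real numbers to
natural numbers other than by branching on a comparison.  Every operation, array access, assignment
and test costs one step. -/

namespace RealRAM

/-- The memory: registers and arrays (`nArr a i j` is the entry `(i, j)` of the array `a`). -/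
structure Store where
  nReg : ℕ → ℕ
  rReg : ℕ → ℝ
  nArr : ℕ → ℕ → ℕ → ℕ
  rArr : ℕ → ℕ → ℕ → ℝ

/-- Index expressions. -/
inductive NExp where
  | const (c : ℕ)
  | reg (x : ℕ)
  | get (a : ℕ) (i j : NExp)
  | add (e f : NExp)
  | sub (e f : NExp)

def NExp.eval (s : Store) : NExp → ℕ
  | const c => c
  | reg x => s.nReg x
  | get a i j => s.nArr a (i.eval s) (j.eval s)
  | add e f => e.eval s + f.eval s
  | sub e f => e.eval s - f.eval s

def NExp.cost : NExp → ℕ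
  | const _ => 1
  | reg _ => 1
  | get _ i j => i.cost + j.cost + 1
  | add e f => e.cost + f.cost + 1
  | sub e f => e.cost + f.cost + 1

/-- Real expressions. -/
inductive RExp where
  | const (c : ℕ)
  | reg (x : ℕ)
  | get (a : ℕ) (i j : NExp)
  | add (e f : RExp)
  | sub (e f : RExp)
  | mul (e f : RExp)
  | div (e f : RExp)

def RExp.eval (s : Store) : RExp → ℝ
  | const c => (c : ℝ)
  | reg x => s.rReg x
  | get a i j => s.rArr a (i.eval s) (j.eval s)
  | add e f => e.eval s + f.eval s
  | sub e f => e.eval s - f.eval s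
  | mul e f => e.eval s * f.eval s
  | div e f => e.eval s / f.eval s

def RExp.cost : RExp → ℕ
  | const _ => 1
  | reg _ => 1
  | get _ i j => i.cost + j.cost + 1
  | add e f => e.cost + f.cost + 1
  | sub e f => e.cost + f.cost + 1
  | mul e f => e.cost + f.cost + 1
  | div e f => e.cost + f.cost + 1

/-- Tests. -/
inductive Test where
  | nLe (e f : NExp)
  | rLe (e f : RExp)
  | neg (b : Test)
  | conj (b c : Test)

def Test.holds (s : Store) : Test → Prop
  | nLe e f => e.eval s ≤ f.eval s
  | rLe e f => e.eval s ≤ f.eval s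
  | neg b => ¬ b.holds s
  | conj b c => b.holds s ∧ c.holds s

def Test.cost : Test → ℕ
  | nLe e f => e.cost + f.cost + 1
  | rLe e f => e.cost + f.cost + 1
  | neg b => b.cost + 1
  | conj b c => b.cost + c.cost + 1

/-- Programs. -/
inductive Prog where
  | skip
  | nSet (x : ℕ) (e : NExp)
  | rSet (x : ℕ) (e : RExp)
  | nPut (a : ℕ) (i j e : NExp)
  | rPut (a : ℕ) (i j : NExp) (e : RExp)
  | seq (P Q : Prog)
  | ite (b : Test) (P Q : Prog)
  | loop (b : Test) (P : Prog)

/-- Overwrite entry `(i, j)` of array `a`. -/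
def put {α : Type} (f : ℕ → ℕ → ℕ → α) (a i j : ℕ) (v : α) : ℕ → ℕ → ℕ → α :=
  Function.update f a (Function.update (f a) i (Function.update (f a i) j v))

/-- `Exec P s s' t`: started in the memory `s`, the program `P` halts after `t` steps in the memory
`s'`.  (`loop b P` repeats `P` while `b` holds.) -/
inductive Exec : Prog → Store → Store → ℕ → Prop
  | skip (s : Store) : Exec .skip s s 1
  | nSet (s : Store) (x : ℕ) (e : NExp) :
      Exec (.nSet x e) s { s with nReg := Function.update s.nReg x (e.eval s) } (e.cost + 1)
  | rSet (s : Store) (x : ℕ) (e : RExp) :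
      Exec (.rSet x e) s { s with rReg := Function.update s.rReg x (e.eval s) } (e.cost + 1)
  | nPut (s : Store) (a : ℕ) (i j e : NExp) :
      Exec (.nPut a i j e) s
        { s with nArr := put s.nArr a (i.eval s) (j.eval s) (e.eval s) }
        (i.cost + j.cost + e.cost + 1)
  | rPut (s : Store) (a : ℕ) (i j : NExp) (e : RExp) :
      Exec (.rPut a i j e) s
        { s with rArr := put s.rArr a (i.eval s) (j.eval s) (e.eval s) }
        (i.cost + j.cost + e.cost + 1)
  | seq (P Q : Prog) (s s' s'' : Store) (t t' : ℕ) :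
      Exec P s s' t → Exec Q s' s'' t' → Exec (.seq P Q) s s'' (t + t')
  | iteTrue (b : Test) (P Q : Prog) (s s' : Store) (t : ℕ) :
      b.holds s → Exec P s s' t → Exec (.ite b P Q) s s' (b.cost + t + 1)
  | iteFalse (b : Test) (P Q : Prog) (s s' : Store) (t : ℕ) :
      ¬ b.holds s → Exec Q s s' t → Exec (.ite b P Q) s s' (b.cost + t + 1)
  | loopDone (b : Test) (P : Prog) (s : Store) :
      ¬ b.holds s → Exec (.loop b P) s s (b.cost + 1)
  | loopStep (b : Test) (P : Prog) (s s' s'' : Store) (t t' : ℕ) :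
      b.holds s → Exec P s s' t → Exec (.loop b P) s' s'' t' →
      Exec (.loop b P) s s'' (b.cost + t + t' + 1)

/-- The memory that holds the input of Layering and zeros elsewhere: `n` and `m` in the index
registers `0` and `1`, `β` in the real register `0`, and the matrix `A`, the vector `δ` and the
estimates `κ̂` in the real arrays `0`, `1` and `2`. -/
def inputStore {m n : ℕ} (A : Matrix (Fin m) (Fin n) ℝ) (β : ℝ) (δ : Fin n → ℝ)
    (κh : Fin n → Fin n → ℝ) : Store where
  nReg x := if x = 0 then n else if x = 1 then m else 0
  rReg x := if x = 0 then β else 0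
  nArr _ _ _ := 0
  rArr a i j :=
    if a = 0 then (if h : i < m ∧ j < n then A ⟨i, h.1⟩ ⟨j, h.2⟩ else 0)
    else if a = 1 then (if h : i < n ∧ j = 0 then δ ⟨i, h.1⟩ else 0)
    else if a = 2 then (if h : i < n ∧ j < n then κh ⟨i, h.1⟩ ⟨j, h.2⟩ else 0)
    else 0

/-- The memory `s` holds the output `(J, κ')`: the number of layers is in the index register `2`, the
number of the layer of each `i` is in the index array `0`, and `κ'` is in the real array `2`. -/
def Holds {n : ℕ} (s : Store) (J : LayeredLS.Layering n) (κ' : Fin n → Fin n → ℝ) : Prop :=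
  s.nReg 2 = J.p ∧ (∀ i : Fin n, s.nArr 0 i 0 = (J.layer i : ℕ)) ∧
    ∀ i j : Fin n, s.rArr 2 i j = κ' i j

end RealRAM

end

noncomputable section

namespace LayeredLS

/-! ### Strongly connected components of semicomplete digraphs -/

/-- A loopless digraph in which any two distinct vertices are joined by at least one edge. -/
structure IsSemicomplete {n : ℕ} (E : Fin n → Fin n → Prop) : Prop where
  irrefl : ∀ i, ¬ E i i
  total : ∀ i j, i ≠ j → E i j ∨ E j i

open Classical in
/-- The in-degree of a vertex. -/
def inDeg {n : ℕ} (E : Fin n → Fin n → Prop) (i : Fin n) : ℕ :=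
  (Finset.univ.filter (fun j => E j i)).card

open Classical in
/-- The out-degree of a vertex. -/
def outDeg {n : ℕ} (E : Fin n → Fin n → Prop) (i : Fin n) : ℕ :=
  (Finset.univ.filter (fun j => E i j)).card

/-- The vertices of in-degree at most `k`. -/
def lowSet {n : ℕ} (E : Fin n → Fin n → Prop) (k : ℕ) : Finset (Fin n) :=
  Finset.univ.filter (fun i => inDeg E i ≤ k)

@[simp] theorem mem_lowSet {n : ℕ} (E : Fin n → Fin n → Prop) (k : ℕ) (i : Fin n) :
    i ∈ lowSet E k ↔ inDeg E i ≤ k := by simp [lowSet]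

/-- There are `k + 1` vertices of in-degree at most `k`; all edges lead from them to the other
vertices, and none leads back. -/
def IsCut {n : ℕ} (E : Fin n → Fin n → Prop) (k : ℕ) : Prop :=
  (lowSet E k).card = k + 1 ∧ ∀ i ∈ lowSet E k, ∀ j ∉ lowSet E k, E i j ∧ ¬ E j i

theorem exists_count_eq (p : ℕ → Prop) [DecidablePred p] (n l : ℕ) (h : l < Nat.count p n) :
    ∃ k < n, p k ∧ Nat.count p k = l := by
  induction n with
  | zero => simp at h
  | succ n ih =>
    by_cases h' : l < Nat.count p n
    · obtain ⟨k, hk, hp⟩ := ih h'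
      exact ⟨k, by omega, hp⟩
    · rw [Nat.count_succ] at h
      by_cases hp : p n
      · rw [if_pos hp] at h
        exact ⟨n, by omega, hp, by omega⟩
      · rw [if_neg hp] at h
        omega

section

variable {n : ℕ} {E : Fin n → Fin n → Prop}

theorem inDeg_lt (hE : IsSemicomplete E) (i : Fin n) : inDeg E i < n := by
  classical
  have h : inDeg E i ≤ (Finset.univ.erase i).card := Finset.card_le_card fun j hj => by
    rw [Finset.mem_erase]
    refine ⟨?_, Finset.mem_univ j⟩
    rintro rfl
    exact hE.irrefl j (by simpa using hj)
  rw [Finset.card_erase_of_mem (Finset.mem_univ i), Finset.card_univ, Fintype.card_fin] at h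
  have := i.pos
  omega

theorem isCut_last (hE : IsSemicomplete E) (hn : 0 < n) : IsCut E (n - 1) := by
  have h : lowSet E (n - 1) = Finset.univ := by
    ext i
    have := inDeg_lt hE i
    simp only [mem_lowSet, Finset.mem_univ, iff_true]
    omega
  refine ⟨?_, fun i _ j hj => absurd (h ▸ Finset.mem_univ j) hj⟩
  rw [h, Finset.card_univ, Fintype.card_fin]
  omega

open Classical in
/-- The strongly connected components of a semicomplete digraph, read off from its cuts. -/
def sccLayering (hE : IsSemicomplete E) (hn : 0 < n) : Layering n where
  p := Nat.count (IsCut E) n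
  layer i := ⟨Nat.count (IsCut E) (inDeg E i), by
    have h1 := inDeg_lt hE i
    have h2 := Nat.count_monotone (IsCut E) (show inDeg E i ≤ n - 1 by omega)
    have h3 := Nat.count_strict_mono (isCut_last hE hn) (show n - 1 < n by omega)
    omega⟩
  surj := by
    rintro ⟨l, hl⟩
    obtain ⟨k, -, hk, hkl⟩ := exists_count_eq _ n l hl
    have hne : (lowSet E k).Nonempty := by
      rw [← Finset.card_pos, hk.1]
      omega
    obtain ⟨i, hi, hmax⟩ := Finset.exists_max_image _ (inDeg E) hne
    refine ⟨i, Fin.ext ?_⟩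
    have hik := (mem_lowSet E k i).1 hi
    change Nat.count (IsCut E) (inDeg E i) = l
    by_contra hcon
    have h1 := Nat.count_monotone (IsCut E) hik
    obtain ⟨d, hdk, hd, hdl⟩ := exists_count_eq (IsCut E) k (Nat.count (IsCut E) (inDeg E i))
      (by omega)
    have hid : inDeg E i ≤ d := by
      by_contra h
      have := Nat.count_strict_mono hd (show d < inDeg E i by omega)
      omega
    have hsub : lowSet E k ⊆ lowSet E d := fun j hj =>
      (mem_lowSet E d j).2 ((hmax j hj).trans hid)
    have := Finset.card_le_card hsub
    rw [hk.1, hd.1] at this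
    omega

theorem layer_le_of_edge (hE : IsSemicomplete E) (hn : 0 < n) {i j : Fin n} (h : E i j) :
    (sccLayering hE hn).layer i ≤ (sccLayering hE hn).layer j := by
  classical
  by_contra hcon
  have hcon : Nat.count (IsCut E) (inDeg E j) < Nat.count (IsCut E) (inDeg E i) := not_le.1 hcon
  obtain ⟨d, hdk, hd, hdl⟩ := exists_count_eq _ _ _ hcon
  have hjd : inDeg E j ≤ d := by
    by_contra h
    have := Nat.count_strict_mono hd (show d < inDeg E j by omega)
    omega
  exact (hd.2 j (by simpa using hjd) i (by simpa using hdk)).2 h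

theorem edge_of_layer_lt (hE : IsSemicomplete E) (hn : 0 < n) {i j : Fin n}
    (h : (sccLayering hE hn).layer i < (sccLayering hE hn).layer j) : E i j ∧ ¬ E j i := by
  have h2 : ¬ E j i := fun h' => (layer_le_of_edge hE hn h').not_gt h
  refine ⟨(hE.total i j ?_).resolve_right h2, h2⟩
  rintro rfl
  exact h.ne rfl

theorem isCut_of_closed (hE : IsSemicomplete E) (R : Finset (Fin n)) (hR : R.Nonempty)
    (hcl : ∀ i ∈ R, ∀ j ∉ R, ¬ E j i) : IsCut E (R.card - 1) ∧ lowSet E (R.card - 1) = R := by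
  classical
  have hpos : 0 < R.card := hR.card_pos
  have hfw : ∀ i ∈ R, ∀ j ∉ R, E i j ∧ ¬ E j i := fun i hi j hj =>
    ⟨(hE.total i j (by rintro rfl; exact hj hi)).resolve_right (hcl i hi j hj), hcl i hi j hj⟩
  have hset : lowSet E (R.card - 1) = R := by
    ext i
    rw [mem_lowSet]
    constructor
    · intro h
      by_contra hi
      have : R.card ≤ inDeg E i := Finset.card_le_card fun j hj => by
        simpa using (hfw j hj i hi).1
      omega
    · intro hi
      have : inDeg E i < R.card := by
        apply Finset.card_lt_card
        rw [Finset.ssubset_iff_of_subset]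
        · exact ⟨i, hi, by simpa using hE.irrefl i⟩
        · intro j hj
          by_contra hj'
          exact (hfw i hi j hj').2 (by simpa using hj)
      omega
  refine ⟨⟨?_, ?_⟩, hset⟩
  · rw [hset]; omega
  · rw [hset]; exact hfw

theorem sccLayering_isSCCListing (hE : IsSemicomplete E) (hn : 0 < n)
    {F : Fin n → Fin n → Prop} (hF : IsSemicomplete F) (hFE : ∀ i j, F i j → E i j) :
    IsSCCListing E F (sccLayering hE hn) := by
  classical
  have hle : ∀ i j, Relation.ReflTransGen E i j →
      (sccLayering hE hn).layer i ≤ (sccLayering hE hn).layer j := by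
    intro i j h
    induction h with
    | refl => exact le_rfl
    | tail _ h ih => exact ih.trans (layer_le_of_edge hE hn h)
  have hreach : ∀ i j, (sccLayering hE hn).layer i = (sccLayering hE hn).layer j →
      Relation.ReflTransGen E i j := by
    intro i j h
    by_contra hcon
    have h : Nat.count (IsCut E) (inDeg E i) = Nat.count (IsCut E) (inDeg E j) :=
      congrArg Fin.val h
    let R : Finset (Fin n) := Finset.univ.filter (fun v => ¬ Relation.ReflTransGen E i v)
    have hmem : ∀ v, v ∈ R ↔ ¬ Relation.ReflTransGen E i v := by simp [R]
    obtain ⟨hc, hs⟩ := isCut_of_closed hE R ⟨j, (hmem j).2 hcon⟩ (by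
      intro u hu v hv huv
      rw [hmem] at hu hv
      exact hu ((not_not.1 hv).tail huv))
    have h1 : inDeg E j ≤ R.card - 1 := by
      rw [← mem_lowSet, hs, hmem]; exact hcon
    have h2 : ¬ inDeg E i ≤ R.card - 1 := by
      rw [← mem_lowSet, hs, hmem, not_not]
    have h3 := Nat.count_strict_mono hc (not_le.1 h2)
    have h4 := Nat.count_monotone (IsCut E) h1
    omega
  refine ⟨fun i j => ⟨fun h => ⟨hreach i j h, hreach j i h.symm⟩,
    fun h => le_antisymm (hle _ _ h.1) (hle _ _ h.2)⟩, fun i j h => ?_⟩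
  have h1 := edge_of_layer_lt hE hn h
  refine (hF.total i j ?_).resolve_right fun h2 => h1.2 (hFE _ _ h2)
  rintro rfl
  exact h.ne rfl

/-- Among the vertices of in-degree at most `k`, a cut is recognized by degree sums. -/
theorem isCut_iff_sum (E : Fin n → Fin n → Prop) (k : ℕ) :
    IsCut E k ↔ (lowSet E k).card = k + 1 ∧
      ∑ i ∈ lowSet E k, outDeg E i = ∑ i ∈ lowSet E k, (inDeg E i + (n - (k + 1))) := by
  classical
  unfold IsCut
  refine and_congr_right fun hcard => ?_
  set S := lowSet E k with hS
  let a : Fin n → Fin n → ℕ := fun i j => if E i j then 1 else 0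
  have ha : ∀ i j, i ∈ S → j ∉ S → a i j ≤ a j i + 1 := by
    intro i j _ _
    simp only [a]
    split_ifs <;> omega
  have hout : ∀ i, outDeg E i = ∑ j ∈ S, a i j + ∑ j ∈ Sᶜ, a i j := by
    intro i
    rw [Finset.sum_add_sum_compl, outDeg, Finset.card_filter]
  have hin : ∀ i, inDeg E i + (n - (k + 1)) = ∑ j ∈ S, a j i + ∑ j ∈ Sᶜ, (a j i + 1) := by
    intro i
    rw [Finset.sum_add_distrib, ← add_assoc, Finset.sum_add_sum_compl, Finset.sum_const,
      Finset.card_compl, hcard, inDeg, Finset.card_filter, Fintype.card_fin, smul_eq_mul, mul_one]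
  simp only [hout, hin, Finset.sum_add_distrib (s := S)]
  rw [Finset.sum_comm (s := S) (t := S), add_right_inj]
  have hle : ∀ i ∈ S, ∑ j ∈ Sᶜ, a i j ≤ ∑ j ∈ Sᶜ, (a j i + 1) := fun i hi =>
    Finset.sum_le_sum fun j hj => ha i j hi (Finset.mem_compl.1 hj)
  rw [Finset.sum_eq_sum_iff_of_le hle]
  refine forall₂_congr fun i hi => ?_
  rw [Finset.sum_eq_sum_iff_of_le fun j hj => ha i j hi (Finset.mem_compl.1 hj)]
  simp only [Finset.mem_compl]
  refine forall₂_congr fun j hj => ?_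
  simp only [a]
  split_ifs <;> simp_all

end

/-! ### The threshold and the digraph of the estimates -/

section

variable {n : ℕ} {W : Submodule ℝ (Vec n)} {β : ℝ} {δ : Fin n → ℝ} {κh : Fin n → Fin n → ℝ}

theorem gam_pos (hn : 0 < n) (hβ : 0 < β) : 0 < gam n β := by
  have : (0 : ℝ) < n := by exact_mod_cast hn
  unfold gam
  positivity

theorem gam_div_pos (hn : 0 < n) (hβ : 0 < β) : 0 < gam n β / n :=
  div_pos (gam_pos hn hβ) (by exact_mod_cast hn)

theorem gam_div_lt_one (hn : 0 < n) (hβ' : β ≤ 1 / 4) : gam n β / n < 1 := by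
  have h1 : (1 : ℝ) ≤ n := by exact_mod_cast hn
  have h2 : (1 : ℝ) ≤ (n : ℝ) ^ 5 := one_le_pow₀ h1
  rw [div_lt_one (by linarith), gam, div_lt_iff₀ (by positivity)]
  nlinarith

theorem estGraph_isSemicomplete (hn : 0 < n) (hβ : 0 < β) (hβ' : β ≤ 1 / 4) (hδ : ∀ i, 0 < δ i)
    (hκ : IsEstimate W κh) : IsSemicomplete (estGraph κh δ (gam n β / n)) := by
  refine ⟨fun i h => h.1 rfl, fun i j hij => ?_⟩
  by_contra hcon
  push Not at hcon
  obtain ⟨h1, h2⟩ := hcon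
  have h1 : κh i j * δ j / δ i < gam n β / n := not_le.1 fun h => h1 ⟨hij, h⟩
  have h2 : κh j i * δ i / δ j < gam n β / n := not_le.1 fun h => h2 ⟨hij.symm, h⟩
  obtain ⟨-, g, -, hgi, hgj, h3, h4⟩ := hκ i j hij
  have hi := hδ i
  have hj := hδ j
  have h5 : |g j / g i| * |g i / g j| = 1 := by
    rw [← abs_mul, div_mul_div_cancel₀ hgi, div_self hgj, abs_one]
  have hp1 : 0 < |g j / g i| := abs_pos.2 (div_ne_zero hgj hgi)
  have hp2 : 0 < |g i / g j| := abs_pos.2 (div_ne_zero hgi hgj)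
  have h6 : 1 ≤ κh i j * κh j i := by
    rw [← h5]
    exact mul_le_mul h3 h4 hp2.le (hp1.le.trans h3)
  have h7 : (κh i j * δ j / δ i) * (κh j i * δ i / δ j) = κh i j * κh j i := by
    field_simp
  have h8 := gam_div_lt_one (β := β) hn hβ'
  have h9 : 0 < κh i j * δ j / δ i := by
    have := hp1.trans_le h3
    positivity
  have h10 : 0 < κh j i * δ i / δ j := by
    have := hp2.trans_le h4
    positivity
  nlinarith

end

/-! ### Circuit imbalances -/

section

variable {n : ℕ} {W : Submodule ℝ (Vec n)} {β : ℝ} {δ : Fin n → ℝ} {κh : Fin n → Fin n → ℝ}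

theorem IsCircuit.div_eq {C : Set (Fin n)} (hC : IsCircuit W C) {g h : Vec n}
    (hg : g ∈ W) (hh : h ∈ W) (hgC : supp g = C) (hhC : supp h = C) {i : Fin n} (hi : i ∈ C)
    (j : Fin n) : g j / g i = h j / h i := by
  obtain ⟨e, he, heC⟩ := hC
  have hgi : g i ≠ 0 := by rw [← hgC] at hi; exact hi
  have hhi : h i ≠ 0 := by rw [← hhC] at hi; exact hi
  have hmem : h i • g - g i • h ∈ W := W.sub_mem (W.smul_mem _ hg) (W.smul_mem _ hh)
  have hzero : h i • g - g i • h = 0 := by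
    by_contra hne
    have hsub : supp (h i • g - g i • h) ⊆ supp e := by
      intro k hk
      rw [heC]
      by_contra hkC
      have h1 : g k = 0 := by
        by_contra h'; exact hkC (hgC ▸ h')
      have h2 : h k = 0 := by
        by_contra h'; exact hkC (hhC ▸ h')
      exact hk (by simp [h1, h2])
    have := he.2.2 _ hmem hne hsub
    have hmem : i ∈ supp (h i • g - g i • h) := by rw [this, heC]; exact hi
    exact hmem (by simp [mul_comm])
  have := congrArg (fun v : Vec n => v j) hzero
  simp only [PiLp.sub_apply, PiLp.smul_apply, smul_eq_mul, PiLp.zero_apply] at this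
  rw [div_eq_div_iff hgi hhi]
  linarith

theorem kappa_bddAbove (W : Submodule ℝ (Vec n)) (i j : Fin n) :
    BddAbove {r : ℝ | ∃ C : Set (Fin n), IsCircuit W C ∧ i ∈ C ∧ j ∈ C ∧
      ∃ g ∈ W, supp g = C ∧ r = |g j / g i|} := by
  rw [Set.ofPred_exists]
  refine (Set.finite_iUnion fun C => Set.Subsingleton.finite ?_).bddAbove
  rintro _ ⟨hC, hi, -, g, hg, hgC, rfl⟩ _ ⟨-, -, -, h, hh, hhC, rfl⟩
  rw [hC.div_eq hg hh hgC hhC hi]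

theorem IsElementary.le_kappa {g : Vec n} (hg : IsElementary W g) {i j : Fin n} (hi : g i ≠ 0)
    (hj : g j ≠ 0) : |g j / g i| ≤ kappa W i j :=
  le_csSup (kappa_bddAbove W i j) ⟨supp g, ⟨g, hg, rfl⟩, hi, hj, g, hg.1, rfl, rfl⟩

theorem mem_rescale_iff (hδ : ∀ i, 0 < δ i) (x : Vec n) :
    x ∈ rescale δ W ↔ WithLp.toLp 2 (fun i => x i / δ i) ∈ W := by
  constructor
  · rintro ⟨y, hy, rfl⟩
    have h : WithLp.toLp 2 (fun i => diagMap δ y i / δ i) = y := by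
      ext i
      simp [diagMap, (hδ i).ne']
    rw [h]
    exact hy
  · intro h
    refine ⟨_, h, ?_⟩
    ext i
    have := (hδ i).ne'
    simp only [diagMap, LinearMap.coe_mk, AddHom.coe_mk]
    field_simp

theorem supp_diagMap (hδ : ∀ i, 0 < δ i) (x : Vec n) : supp (diagMap δ x) = supp x := by
  ext i
  simp [supp, diagMap, (hδ i).ne']

theorem diagMap_isElementary (hδ : ∀ i, 0 < δ i) {g : Vec n} (hg : IsElementary W g) :
    IsElementary (rescale δ W) (diagMap δ g) := by
  refine ⟨⟨g, hg.1, rfl⟩, fun h => hg.2.1 ?_, ?_⟩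
  · ext i
    have := congrArg (fun v : Vec n => v i) h
    simpa [diagMap, (hδ i).ne'] using this
  · rintro _ ⟨h, hh, rfl⟩ hne hsub
    rw [supp_diagMap hδ, supp_diagMap hδ] at *
    exact hg.2.2 h hh (fun h0 => hne (by rw [h0, map_zero])) hsub

theorem kappa_mul_le (hδ : ∀ i, 0 < δ i) {i j : Fin n}
    (hij : ∃ g, IsElementary W g ∧ g i ≠ 0 ∧ g j ≠ 0) :
    kappa W i j * δ j / δ i ≤ kappa (rescale δ W) i j := by
  have hi := hδ i
  have hj := hδ j
  rw [mul_div_assoc, ← le_div_iff₀ (by positivity)]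
  apply csSup_le
  · obtain ⟨g, hg, h1, h2⟩ := hij
    exact ⟨_, supp g, ⟨g, hg, rfl⟩, h1, h2, g, hg.1, rfl, rfl⟩
  · rintro _ ⟨C, ⟨e, he, rfl⟩, hiC, hjC, g, hg, hgC, rfl⟩
    rw [IsCircuit.div_eq ⟨e, he, rfl⟩ hg he.1 hgC rfl hiC]
    have h1 : e i ≠ 0 := hiC
    have h2 : e j ≠ 0 := hjC
    have := (diagMap_isElementary hδ he).le_kappa (i := i) (j := j)
      (by simpa [diagMap, hi.ne'] using h1) (by simpa [diagMap, hj.ne'] using h2)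
    simp only [diagMap, LinearMap.coe_mk, AddHom.coe_mk] at this
    rw [le_div_iff₀ (by positivity)]
    refine le_trans (le_of_eq ?_) this
    rw [mul_comm (δ j), mul_comm (δ i), mul_div_mul_comm, abs_mul, abs_of_pos (div_pos hj hi)]

theorem estGraph_le_auxGraph (hδ : ∀ i, 0 < δ i) (hκ : IsEstimate W κh) {σ : ℝ} {i j : Fin n}
    (h : estGraph κh δ σ i j) : auxGraph W δ σ i j := by
  obtain ⟨hij, h⟩ := h
  obtain ⟨h1, g, hg, hgi, hgj, -, -⟩ := hκ i j hij
  refine h.trans (le_trans ?_ (kappa_mul_le hδ ⟨g, hg, hgi, hgj⟩))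
  have := hδ i
  have := hδ j
  gcongr

/-! ### Outputs of the subroutine are balanced -/

/-- What the main loop of the subroutine guarantees: the added edges are edges of the auxiliary
digraph, and for each treated layer either the lifting score is small or a backward edge was
added. -/
theorem LoopState.spec (hδ : ∀ i, 0 < δ i) (hκ : IsEstimate W κh) {C : Layering n} {k : ℕ}
    {κ' : Fin n → Fin n → ℝ} {E : Fin n → Fin n → Prop} (h : LoopState W β δ κh C k κ' E) :
    (∀ i j, estGraph κh δ (gam n β / n) i j → E i j) ∧
    (∀ i j, E i j → i ≠ j ∧ auxGraph W δ (gam n β / n) i j) ∧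
    ∀ l, 0 < l → l < k → liftScore (rescale δ W) (C.upper l) ≤ gam n β ∨
      ∃ i ∈ C.upper l, ∃ j ∉ C.upper l, E i j := by
  induction h with
  | start =>
    exact ⟨fun _ _ h => h, fun i j h => ⟨h.1, estGraph_le_auxGraph hδ hκ h⟩,
      fun l h1 h2 => by omega⟩
  | pass k κ' E _ _ hv ih =>
    refine ⟨ih.1, ih.2.1, fun l h1 h2 => ?_⟩
    by_cases hl : l = k
    · subst hl
      exact Or.inl hv
    · exact ih.2.2 l h1 (by omega)
  | fail k κ' E i j t _ _ hv ih =>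
    obtain ⟨hi, hj, h1, h2⟩ := hv
    refine ⟨fun a b h => Or.inl (ih.1 a b h), ?_, fun l h1 h2 => ?_⟩
    · rintro a b (h | ⟨rfl, rfl⟩)
      · exact ih.2.1 a b h
      · refine ⟨?_, h1.trans h2⟩
        rintro rfl
        exact hj hi
    · by_cases hl : l = k
      · subst hl
        exact Or.inr ⟨i, hi, j, hj, Or.inr ⟨rfl, rfl⟩⟩
      · obtain h | ⟨a, ha, b, hb, hab⟩ := ih.2.2 l h1 (by omega)
        · exact Or.inl h
        · exact Or.inr ⟨a, ha, b, hb, Or.inl hab⟩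

@[simp] theorem Layering.mem_upper (J : Layering n) (k : ℕ) (i : Fin n) :
    i ∈ J.upper k ↔ k ≤ (J.layer i : ℕ) := by simp [Layering.upper]

/-- A proper final segment of the strongly connected components of a larger digraph is a proper
final segment of the strongly connected components of the smaller one. -/
theorem IsSCCListing.exists_upper_eq {E F : Fin n → Fin n → Prop} {C J : Layering n}
    (hFE : ∀ i j, F i j → E i j) (hC : IsSCCListing F F C) (hJ : IsSCCListing E F J) {k : ℕ}
    (hk : 0 < k) (hkp : k < J.p) :
    (∀ u ∈ J.upper k, ∀ v ∉ J.upper k, ¬ E u v) ∧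
      ∃ l, 0 < l ∧ l < C.p ∧ J.upper k = C.upper l := by
  have hback : ∀ u ∈ J.upper k, ∀ v ∉ J.upper k, ¬ E u v := by
    intro u hu v hv huv
    rw [Layering.mem_upper] at hu hv
    have hlt : J.layer v < J.layer u := Fin.lt_def.2 (by omega)
    have := (hJ.1 u v).2 ⟨.single huv, .single (hFE _ _ (hJ.2 v u hlt))⟩
    rw [this] at hlt
    exact hlt.ne rfl
  have hclosed : ∀ u v, u ∈ J.upper k → Relation.ReflTransGen F u v → v ∈ J.upper k := by
    intro u v hu h
    induction h with
    | refl => exact hu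
    | tail _ h ih =>
      by_contra hcon
      exact hback _ ih _ hcon (hFE _ _ h)
  have hlt : ∀ u ∈ J.upper k, ∀ v ∉ J.upper k, C.layer v < C.layer u := by
    intro u hu v hv
    rcases lt_trichotomy (C.layer v) (C.layer u) with h | h | h
    · exact h
    · exact absurd (hclosed u v hu ((hC.1 v u).1 h).2) hv
    · exact absurd (hclosed u v hu (.single (hC.2 u v h))) hv
  have hne : (J.upper k).Nonempty := by
    obtain ⟨i, hi⟩ := J.surj ⟨k, hkp⟩
    exact ⟨i, by simp [hi]⟩
  obtain ⟨v, hv⟩ := J.surj ⟨0, hk.trans hkp⟩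
  have hv : v ∉ J.upper k := by simp [hv]; omega
  obtain ⟨u, hu, hmin⟩ := Finset.exists_min_image _ (fun i => (C.layer i : ℕ)) hne
  refine ⟨hback, C.layer u, ?_, (C.layer u).2, ?_⟩
  · have := Fin.lt_def.1 (hlt u hu v hv)
    omega
  · ext w
    rw [Layering.mem_upper C]
    refine ⟨hmin w, fun h => ?_⟩
    by_contra hw
    have := Fin.lt_def.1 (hlt u hu w hw)
    omega

theorem stronglyConnectedIn_part {E F G : Fin n → Fin n → Prop} {J : Layering n}
    (hJ : IsSCCListing E F J) (hEG : ∀ i j, E i j → G i j) (k : Fin J.p) :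
    StronglyConnectedIn G (J.part k) := by
  intro i hi j hj
  have hi' : J.layer i = k := by simpa [Layering.part] using hi
  have hj' : J.layer j = k := by simpa [Layering.part] using hj
  obtain ⟨hij, hji⟩ := (hJ.1 i j).1 (hi'.trans hj'.symm)
  induction hij using Relation.ReflTransGen.head_induction_on with
  | refl => exact .refl
  | head h hcj ih =>
    rename_i a c
    have hc : J.layer c = k := by
      rw [← hi', (hJ.1 c a).2 ⟨hcj.trans hji, .single h⟩]
    have hcm : c ∈ J.part k := by simpa [Layering.part] using hc
    exact .head ⟨hi, hcm, hEG _ _ h⟩ (ih hcm hc (hji.tail h))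

theorem LayeringReturns.isBalanced (hn : 0 < n) (hβ : 0 < β) (hδ : ∀ i, 0 < δ i)
    (hκ : IsEstimate W κh) {J : Layering n} {κ' : Fin n → Fin n → ℝ}
    (h : LayeringReturns W β δ κh J κ') : IsBalanced W β δ J := by
  obtain ⟨C, E, hC, hloop, hJ⟩ := h
  obtain ⟨h1, h2, h3⟩ := hloop.spec hδ hκ
  refine ⟨Real.iSup_le ?_ (gam_pos hn hβ).le, stronglyConnectedIn_part hJ fun i j h => (h2 i j h).2⟩
  rintro ⟨k, hk⟩
  obtain ⟨hback, l, hl, hlp, heq⟩ := IsSCCListing.exists_upper_eq h1 hC hJ hk k.2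
  change liftScore _ (J.upper k) ≤ _
  rw [heq] at hback ⊢
  refine (h3 l hl hlp).resolve_right ?_
  rintro ⟨i, hi, j, hj, hij⟩
  exact hback i hi j hj hij

end

/-! ### Tableaus -/

/-- The rows of `T` describe the subspace `U`, and column `c r` is the unit vector `r`. -/
structure IsTableau {m n : ℕ} (U : Submodule ℝ (Vec n)) (T : Fin m → Fin n → ℝ)
    (c : Fin m → Fin n) : Prop where
  mem_iff : ∀ x : Vec n, x ∈ U ↔ ∀ r, ∑ i, T r i * x i = 0
  pivot : ∀ r r', T r (c r') = if r = r' then 1 else 0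

section

variable {m n : ℕ} {U : Submodule ℝ (Vec n)} {T : Fin m → Fin n → ℝ} {c : Fin m → Fin n}
  {δ : Fin n → ℝ}

theorem IsTableau.injective (hT : IsTableau U T c) : Function.Injective c := by
  intro r r' h
  have h1 := hT.pivot r r'
  rw [← h, hT.pivot, if_pos rfl] at h1
  by_contra hne
  simp [hne] at h1

theorem IsTableau.rescale (hT : IsTableau U T c) (hδ : ∀ i, 0 < δ i) :
    IsTableau (rescale δ U) (fun r i => δ (c r) * T r i / δ i) c := by
  refine ⟨fun x => ?_, fun r r' => ?_⟩
  · rw [mem_rescale_iff hδ, hT.mem_iff]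
    refine forall_congr' fun r => ?_
    have : ∑ i, δ (c r) * T r i / δ i * x i = δ (c r) * ∑ i, T r i * (x i / δ i) := by
      rw [Finset.mul_sum]
      exact Finset.sum_congr rfl fun i _ => by ring
    rw [this, mul_eq_zero, or_iff_right (hδ _).ne']
  · by_cases h : r = r'
    · subst h
      simp [hT.pivot, (hδ _).ne']
    · simp [hT.pivot, h]

/-- Off its pivot columns, the entries of a tableau are circuit imbalances. -/
theorem IsTableau.le_kappa (hT : IsTableau U T c) {r : Fin m} {i : Fin n} (hi : i ≠ c r)
    (hne : T r i ≠ 0) : |T r i| ≤ kappa U i (c r) := by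
  classical
  have hic : ∀ r', i ≠ c r' := by
    rintro r' rfl
    rw [hT.pivot] at hne
    simp only [ne_eq, ite_eq_right_iff, one_ne_zero, imp_false, not_not] at hne
    exact hi (by rw [hne])
  let g : Vec n := WithLp.toLp 2 fun j =>
    (if j = i then 1 else 0) - ∑ r', if c r' = j then T r' i else 0
  have hgi : g i = 1 := by
    simp [g, fun r' => (hic r').symm]
  have hgc : ∀ r', g (c r') = -T r' i := by
    intro r'
    simp [g, (hic r').symm, hT.injective.eq_iff]
  have hg0 : ∀ j, j ≠ i → (∀ r', c r' ≠ j) → g j = 0 := by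
    intro j hj hc
    simp [g, hj, hc]
  have hgU : g ∈ U := by
    rw [hT.mem_iff]
    intro q
    simp only [g, mul_sub, Finset.sum_sub_distrib, Finset.mul_sum]
    rw [Finset.sum_comm]
    simp [hT.pivot]
  have hel : IsElementary U g := by
    refine ⟨hgU, fun h => ?_, fun h hh hne hsub => ?_⟩
    · rw [h] at hgi
      simp at hgi
    · have hzero : ∀ j, j ≠ i → (∀ r', c r' ≠ j) → h j = 0 := by
        intro j hj hc
        by_contra h'
        exact hsub h' (hg0 j hj hc)
      have heq : h = h i • g := by
        have hd : h - h i • g ∈ U := U.sub_mem hh (U.smul_mem _ hgU)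
        have hoff : ∀ j, (∀ r', c r' ≠ j) → (h - h i • g) j = 0 := by
          intro j hc
          by_cases hj : j = i
          · subst hj
            simp [hgi]
          · simp [hzero j hj hc, hg0 j hj hc]
        rw [hT.mem_iff] at hd
        rw [← sub_eq_zero]
        ext j
        by_cases hc : ∃ r', c r' = j
        · obtain ⟨r', rfl⟩ := hc
          have := hd r'
          rw [Finset.sum_eq_single (c r')] at this
          · simpa [hT.pivot] using this
          · intro b _ hb
            by_cases hcb : ∃ q, c q = b
            · obtain ⟨q, rfl⟩ := hcb
              have : r' ≠ q := by rintro rfl; exact hb rfl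
              simp [hT.pivot, this]
            · rw [hoff b (by simpa using hcb), mul_zero]
          · simp
        · rw [hoff j (by simpa using hc)]
          simp
      have hhi : h i ≠ 0 := by
        intro h0
        rw [h0, zero_smul] at heq
        exact hne heq
      rw [heq]
      ext j
      simp [supp, hhi]
  have := hel.le_kappa (i := i) (j := c r) (by simp [hgi]) (by simpa [hgc] using hne)
  simpa [hgi, hgc] using this

/-- If the rows with pivot in `I` vanish off `I`, and the entries of the other rows in `I` are small,
then so is the lifting score of `I`. -/
theorem IsTableau.liftScore_le (hT : IsTableau U T c) (I : Finset (Fin n))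
    (hI : ∀ r, c r ∈ I → ∀ j ∉ I, T r j = 0) {θ : ℝ} (hθ : 0 ≤ θ)
    (hsmall : ∀ r, c r ∉ I → ∀ i ∈ I, |T r i| ≤ θ / n) : liftScore U I ≤ θ := by
  classical
  have hnorm : liftNorm U I ≤ Real.sqrt (1 + θ ^ 2) := by
    refine ContinuousLinearMap.opNorm_le_bound _ (Real.sqrt_nonneg _) ?_
    rintro ⟨p, u, hu, rfl⟩
    have hu : u ∈ U := hu
    let z : Vec n := WithLp.toLp 2 fun j =>
      if j ∈ I then u j else -∑ r, if c r = j then ∑ i ∈ I, T r i * u i else 0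
    have hzI : ∀ j ∈ I, z j = u j := by
      intro j hj
      simp [z, hj]
    have hzc : ∀ r, c r ∉ I → z (c r) = -∑ i ∈ I, T r i * u i := by
      intro r hr
      simp [z, hr, hT.injective.eq_iff]
    have hz0 : ∀ j ∉ I, (∀ r, c r ≠ j) → z j = 0 := by
      intro j hj hc
      simp [z, hj, hc]
    have hzU : z ∈ U := by
      rw [hT.mem_iff] at hu ⊢
      intro q
      rw [← Finset.sum_add_sum_compl I]
      have h1 : ∑ i ∈ I, T q i * z i = ∑ i ∈ I, T q i * u i :=
        Finset.sum_congr rfl fun i hi => by rw [hzI i hi]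
      rw [h1]
      by_cases hq : c q ∈ I
      · have h2 : ∀ x : Vec n, ∑ i ∈ Iᶜ, T q i * x i = 0 := fun x =>
          Finset.sum_eq_zero fun i hi => by rw [hI q hq i (Finset.mem_compl.1 hi), zero_mul]
        have h3 := hu q
        rw [← Finset.sum_add_sum_compl I, h2] at h3
        rw [h2, h3]
      · rw [Finset.sum_eq_single_of_mem (c q) (Finset.mem_compl.2 hq), hzc q hq, hT.pivot,
          if_pos rfl, one_mul, add_neg_cancel]
        intro j hj hjq
        have hj := Finset.mem_compl.1 hj
        by_cases hc : ∃ r, c r = j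
        · obtain ⟨r, rfl⟩ := hc
          have : q ≠ r := by rintro rfl; exact hjq rfl
          simp [hT.pivot, this]
        · rw [hz0 j hj (by simpa using hc), mul_zero]
    set p : U.map (coordProj I) := ⟨coordProj I u, u, hu, rfl⟩ with hp
    have hzp : coordProj I z = p := by
      ext i
      exact hzI i i.2
    have hle := liftMap_min U I p ⟨z, hzU⟩ hzp
    refine le_trans (show _ ≤ ‖z‖ from hle) ?_
    have hpn : ‖p‖ ^ 2 = ∑ i ∈ I, u i ^ 2 := by
      rw [Submodule.coe_norm, EuclideanSpace.real_norm_sq_eq, ← Finset.sum_coe_sort I]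
      rfl
    have hzj : ∀ j ∈ Iᶜ, z j ^ 2 ≤ n * (θ / n) ^ 2 * ‖p‖ ^ 2 := by
      intro j hj
      have hj := Finset.mem_compl.1 hj
      by_cases hc : ∃ r, c r = j
      · obtain ⟨r, rfl⟩ := hc
        rw [hzc r hj, neg_sq, hpn]
        refine (Finset.sum_mul_sq_le_sq_mul_sq I _ _).trans ?_
        refine mul_le_mul_of_nonneg_right ?_ (Finset.sum_nonneg fun _ _ => sq_nonneg _)
        have h1 : ∑ i ∈ I, T r i ^ 2 ≤ ∑ i ∈ I, (θ / n) ^ 2 := Finset.sum_le_sum fun i hi =>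
          sq_le_sq' (by linarith [abs_le.1 (hsmall r hj i hi)]) (abs_le.1 (hsmall r hj i hi)).2
        refine h1.trans ?_
        rw [Finset.sum_const, nsmul_eq_mul]
        refine mul_le_mul_of_nonneg_right ?_ (sq_nonneg _)
        exact_mod_cast (Finset.card_le_univ I).trans_eq (Fintype.card_fin n)
      · rw [hz0 j hj (by simpa using hc)]
        simp only [ne_eq, OfNat.ofNat_ne_zero, not_false_eq_true, zero_pow]
        positivity
    have hsq : ‖z‖ ^ 2 ≤ (1 + θ ^ 2) * ‖p‖ ^ 2 := by
      rw [EuclideanSpace.real_norm_sq_eq, ← Finset.sum_add_sum_compl I,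
        Finset.sum_congr rfl fun i hi => by rw [hzI i hi], ← hpn]
      have h1 := Finset.sum_le_sum hzj
      rw [Finset.sum_const, nsmul_eq_mul] at h1
      have h2 : ((Iᶜ.card : ℕ) : ℝ) ≤ n := by
        exact_mod_cast (Finset.card_le_univ Iᶜ).trans_eq (Fintype.card_fin n)
      have h3 : (Iᶜ.card : ℝ) * (n * (θ / n) ^ 2 * ‖p‖ ^ 2) ≤ θ ^ 2 * ‖p‖ ^ 2 := by
        refine (mul_le_mul_of_nonneg_right h2 (by positivity)).trans ?_
        rcases Nat.eq_zero_or_pos n with hn | hn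
        · subst hn
          simp only [Nat.cast_zero, zero_mul]
          positivity
        · have : (n : ℝ) ≠ 0 := by exact_mod_cast hn.ne'
          apply le_of_eq
          field_simp
      linarith
    rw [← Real.sqrt_sq (norm_nonneg z), ← Real.sqrt_sq (norm_nonneg p), ← Real.sqrt_mul (by positivity)]
    exact Real.sqrt_le_sqrt hsq
  have h0 : 0 ≤ liftNorm U I := norm_nonneg (LinearMap.toContinuousLinearMap (liftMap U I))
  rw [liftScore]
  apply Real.sqrt_le_iff.2 ⟨hθ, ?_⟩
  have := (Real.le_sqrt h0 (by positivity)).1 hnorm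
  linarith

/-! ### Gauss–Jordan elimination -/

/-- Divide row `r` by its entry in column `c`, and clear the rest of that column. -/
def elimStep (T : Fin m → Fin n → ℝ) (r : Fin m) (c : Fin n) : Fin m → Fin n → ℝ :=
  fun q j => if q = r then T r j / T r c else T q j - T q c * (T r j / T r c)

/-- The state of the elimination when the rows `0, …, k - 1` have been treated; the pivots are
chosen to be of minimal rank with respect to `w`. -/
structure ElimState (U : Submodule ℝ (Vec n)) (w : Fin n → ℕ) (k : ℕ) (T : Fin m → Fin n → ℝ)
    (c : Fin m → Fin n) : Prop where
  mem_iff : ∀ x : Vec n, x ∈ U ↔ ∀ r, ∑ i, T r i * x i = 0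
  pivot : ∀ r r' : Fin m, (r' : ℕ) < k → T r (c r') = if r = r' then 1 else 0
  minimal : ∀ r : Fin m, (r : ℕ) < k → ∀ j, T r j ≠ 0 → w (c r) ≤ w j

variable {w : Fin n → ℕ} {k : ℕ}

theorem ElimState.step {r : Fin m} {p : Fin n} (h : ElimState U w r T c) (hp : T r p ≠ 0)
    (hmin : ∀ j, T r j ≠ 0 → w p ≤ w j) :
    ElimState U w (r + 1) (elimStep T r p) (Function.update c r p) := by
  have hrow : ∀ (x : Vec n) q, ∑ i, elimStep T r p q i * x i =
      if q = r then (∑ i, T r i * x i) / T r p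
      else ∑ i, T q i * x i - T q p / T r p * ∑ i, T r i * x i := by
    intro x q
    by_cases hq : q = r
    · simp only [elimStep, hq, if_true, Finset.sum_div]
      exact Finset.sum_congr rfl fun i _ => by ring
    · simp only [elimStep, hq, if_false, Finset.mul_sum, ← Finset.sum_sub_distrib]
      exact Finset.sum_congr rfl fun i _ => by ring
  have hrc : ∀ r' : Fin m, (r' : ℕ) < r → T r (c r') = 0 := by
    intro r' hr'
    rw [h.pivot r r' hr', if_neg]
    rintro rfl
    exact lt_irrefl _ hr'
  refine ⟨fun x => ?_, fun q r' hr' => ?_, fun q hq j hj => ?_⟩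
  · rw [h.mem_iff]
    constructor
    · intro hx q
      rw [hrow, hx, hx]
      simp
    · intro hx
      have hr : ∑ i, T r i * x i = 0 := by
        have := hx r
        rw [hrow, if_pos rfl, div_eq_zero_iff] at this
        exact this.resolve_right hp
      intro q
      by_cases hq : q = r
      · rw [hq, hr]
      · have := hx q
        rwa [hrow, if_neg hq, hr, mul_zero, sub_zero] at this
  · by_cases hrr : r' = r
    · subst hrr
      by_cases hq : q = r'
      · simp [elimStep, hq, hp]
      · simp [elimStep, hq, hp]
    · have hlt : (r' : ℕ) < r := by
        have : (r' : ℕ) ≠ r := fun h => hrr (Fin.ext h)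
        omega
      rw [Function.update_of_ne hrr]
      by_cases hq : q = r
      · subst hq
        rw [elimStep, if_pos rfl, hrc r' hlt, zero_div, if_neg (Ne.symm hrr)]
      · rw [elimStep, if_neg hq, hrc r' hlt, zero_div, mul_zero, sub_zero, h.pivot q r' hlt]
  · by_cases hqr : q = r
    · subst hqr
      rw [Function.update_self]
      refine hmin j fun h0 => hj ?_
      rw [elimStep, if_pos rfl, h0, zero_div]
    · have hlt : (q : ℕ) < r := by
        have : (q : ℕ) ≠ r := fun h => hqr (Fin.ext h)
        omega
      rw [Function.update_of_ne hqr]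
      rw [elimStep, if_neg hqr] at hj
      by_cases hqj : T q j = 0
      · rw [hqj, zero_sub, neg_ne_zero] at hj
        have h1 := h.minimal q hlt p (left_ne_zero_of_mul hj)
        have h2 := hmin j fun h0 => hj (by rw [h0, zero_div, mul_zero])
        exact h1.trans h2
      · exact h.minimal q hlt j hqj

theorem ElimState.isTableau (h : ElimState U w m T c) : IsTableau U T c :=
  ⟨h.mem_iff, fun r r' => h.pivot r r' r'.2⟩

theorem mem_kerSpace_iff (A : Matrix (Fin m) (Fin n) ℝ) (x : Vec n) :
    x ∈ kerSpace A ↔ ∀ r, ∑ i, A r i * x i = 0 := by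
  rw [kerSpace, LinearMap.mem_ker]
  constructor
  · intro h r
    exact congrArg (fun v : EuclideanSpace ℝ (Fin m) => v r) h
  · intro h
    ext r
    exact h r

/-- If a matrix of full row rank has the same kernel as `T`, then `T` has no zero row. -/
theorem exists_ne_zero_of_rank {A : Matrix (Fin m) (Fin n) ℝ} (hA : A.rank = m)
    (hT : ∀ x : Vec n, x ∈ kerSpace A ↔ ∀ r, ∑ i, T r i * x i = 0) (r : Fin m) :
    ∃ j, T r j ≠ 0 := by
  by_contra hcon
  push Not at hcon
  have hker : LinearMap.ker (Matrix.of T).mulVecLin = LinearMap.ker A.mulVecLin := by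
    ext x
    have := hT (WithLp.toLp 2 x)
    rw [mem_kerSpace_iff] at this
    rw [LinearMap.mem_ker, LinearMap.mem_ker, funext_iff, funext_iff]
    exact this.symm
  have h1 := LinearMap.finrank_range_add_finrank_ker A.mulVecLin
  have h2 := LinearMap.finrank_range_add_finrank_ker (Matrix.of T).mulVecLin
  have hTr : (Matrix.of T).rank = m := by
    rw [hker, ← h1] at h2
    exact (Nat.add_right_cancel h2).trans hA
  have hlt : (Matrix.of T).rank < m := by
    rw [Matrix.rank]
    have hsub : LinearMap.range (Matrix.of T).mulVecLin ≤
        LinearMap.ker (LinearMap.proj (R := ℝ) (φ := fun _ : Fin m => ℝ) r) := by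
      rintro _ ⟨x, rfl⟩
      rw [LinearMap.mem_ker]
      change ∑ i, T r i * x i = 0
      simp [hcon]
    have hne : LinearMap.ker (LinearMap.proj (R := ℝ) (φ := fun _ : Fin m => ℝ) r) ≠ ⊤ := by
      intro h
      have : Pi.single r (1 : ℝ) ∈ LinearMap.ker
        (LinearMap.proj (R := ℝ) (φ := fun _ : Fin m => ℝ) r) := h ▸ Submodule.mem_top
      simp at this
    calc _ ≤ _ := Submodule.finrank_mono hsub
      _ < _ := Submodule.finrank_lt hne
      _ = m := by simp
  omega

end

end LayeredLS

end

noncomputable section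

namespace RealRAM

/-! ### Reasoning about programs -/

namespace Store

/-- Overwrite an index register. -/
def setN (s : Store) (x v : ℕ) : Store := { s with nReg := Function.update s.nReg x v }

/-- Overwrite a real register. -/
def setR (s : Store) (x : ℕ) (v : ℝ) : Store := { s with rReg := Function.update s.rReg x v }

/-- Overwrite an entry of an index array. -/
def putN (s : Store) (a i j v : ℕ) : Store := { s with nArr := put s.nArr a i j v }

/-- Overwrite an entry of a real array. -/
def putR (s : Store) (a i j : ℕ) (v : ℝ) : Store := { s with rArr := put s.rArr a i j v }

section

variable (s : Store)

@[simp] theorem setN_nReg (x v y : ℕ) :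
    (s.setN x v).nReg y = if y = x then v else s.nReg y := by
  simp [setN, Function.update_apply]
@[simp] theorem setN_rReg (x v : ℕ) : (s.setN x v).rReg = s.rReg := rfl
@[simp] theorem setN_nArr (x v : ℕ) : (s.setN x v).nArr = s.nArr := rfl
@[simp] theorem setN_rArr (x v : ℕ) : (s.setN x v).rArr = s.rArr := rfl
@[simp] theorem setR_nReg (x : ℕ) (v : ℝ) : (s.setR x v).nReg = s.nReg := rfl
@[simp] theorem setR_rReg (x : ℕ) (v : ℝ) (y : ℕ) :
    (s.setR x v).rReg y = if y = x then v else s.rReg y := by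
  simp [setR, Function.update_apply]
@[simp] theorem setR_nArr (x : ℕ) (v : ℝ) : (s.setR x v).nArr = s.nArr := rfl
@[simp] theorem setR_rArr (x : ℕ) (v : ℝ) : (s.setR x v).rArr = s.rArr := rfl

theorem put_apply {α : Type} (f : ℕ → ℕ → ℕ → α) (a i j : ℕ) (v : α) (a' i' j' : ℕ) :
    put f a i j v a' i' j' = if a' = a ∧ i' = i ∧ j' = j then v else f a' i' j' := by
  by_cases ha : a' = a
  · subst ha
    by_cases hi : i' = i
    · subst hi
      by_cases hj : j' = j
      · subst hj; simp [put]
      · simp [put, hj]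
    · simp [put, hi]
  · simp [put, ha]

@[simp] theorem putN_nReg (a i j v : ℕ) : (s.putN a i j v).nReg = s.nReg := rfl
@[simp] theorem putN_rReg (a i j v : ℕ) : (s.putN a i j v).rReg = s.rReg := rfl
@[simp] theorem putN_nArr (a i j v a' i' j' : ℕ) : (s.putN a i j v).nArr a' i' j' =
    if a' = a ∧ i' = i ∧ j' = j then v else s.nArr a' i' j' := put_apply ..
@[simp] theorem putN_rArr (a i j v : ℕ) : (s.putN a i j v).rArr = s.rArr := rfl
@[simp] theorem putR_nReg (a i j : ℕ) (v : ℝ) : (s.putR a i j v).nReg = s.nReg := rfl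
@[simp] theorem putR_rReg (a i j : ℕ) (v : ℝ) : (s.putR a i j v).rReg = s.rReg := rfl
@[simp] theorem putR_nArr (a i j : ℕ) (v : ℝ) : (s.putR a i j v).nArr = s.nArr := rfl
@[simp] theorem putR_rArr (a i j : ℕ) (v : ℝ) (a' i' j' : ℕ) : (s.putR a i j v).rArr a' i' j' =
    if a' = a ∧ i' = i ∧ j' = j then v else s.rArr a' i' j' := put_apply ..

end

end Store

namespace Prog

/-- The index registers that a program may change. -/
def nRegs : Prog → List ℕ
  | nSet x _ => [x]
  | seq P Q => P.nRegs ++ Q.nRegs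
  | ite _ P Q => P.nRegs ++ Q.nRegs
  | loop _ P => P.nRegs
  | _ => []

/-- The real registers that a program may change. -/
def rRegs : Prog → List ℕ
  | rSet x _ => [x]
  | seq P Q => P.rRegs ++ Q.rRegs
  | ite _ P Q => P.rRegs ++ Q.rRegs
  | loop _ P => P.rRegs
  | _ => []

/-- The index arrays that a program may change. -/
def nArrs : Prog → List ℕ
  | nPut a _ _ _ => [a]
  | seq P Q => P.nArrs ++ Q.nArrs
  | ite _ P Q => P.nArrs ++ Q.nArrs
  | loop _ P => P.nArrs
  | _ => []

/-- The real arrays that a program may change. -/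
def rArrs : Prog → List ℕ
  | rPut a _ _ _ => [a]
  | seq P Q => P.rArrs ++ Q.rArrs
  | ite _ P Q => P.rArrs ++ Q.rArrs
  | loop _ P => P.rArrs
  | _ => []

/-- An upper bound on the number of steps of a program without loops. -/
def bound : Prog → ℕ
  | skip => 1
  | nSet _ e => e.cost + 1
  | rSet _ e => e.cost + 1
  | nPut _ i j e => i.cost + j.cost + e.cost + 1
  | rPut _ i j e => i.cost + j.cost + e.cost + 1
  | seq P Q => P.bound + Q.bound
  | ite b P Q => b.cost + max P.bound Q.bound + 1
  | loop _ _ => 0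

/-- The weakest precondition of a program without loops. -/
def wp : Prog → (Store → Prop) → Store → Prop
  | skip, Q, s => Q s
  | nSet x e, Q, s => Q (s.setN x (e.eval s))
  | rSet x e, Q, s => Q (s.setR x (e.eval s))
  | nPut a i j e, Q, s => Q (s.putN a (i.eval s) (j.eval s) (e.eval s))
  | rPut a i j e, Q, s => Q (s.putR a (i.eval s) (j.eval s) (e.eval s))
  | seq P P', Q, s => P.wp (P'.wp Q) s
  | ite b P P', Q, s => (b.holds s → P.wp Q s) ∧ (¬ b.holds s → P'.wp Q s)
  | loop _ _, _, _ => False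

end Prog

/-- The memories `s` and `s'` agree outside the registers and arrays that `P` may change. -/
structure Frame (P : Prog) (s s' : Store) : Prop where
  nReg : ∀ {x}, x ∉ P.nRegs → s'.nReg x = s.nReg x
  rReg : ∀ {x}, x ∉ P.rRegs → s'.rReg x = s.rReg x
  nArr : ∀ {a}, a ∉ P.nArrs → s'.nArr a = s.nArr a
  rArr : ∀ {a}, a ∉ P.rArrs → s'.rArr a = s.rArr a

theorem Frame.refl (P : Prog) (s : Store) : Frame P s s :=
  ⟨fun _ => rfl, fun _ => rfl, fun _ => rfl, fun _ => rfl⟩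

theorem Frame.trans {P : Prog} {s s' s'' : Store} (h : Frame P s s') (h' : Frame P s' s'') :
    Frame P s s'' :=
  ⟨fun hx => (h'.nReg hx).trans (h.nReg hx), fun hx => (h'.rReg hx).trans (h.rReg hx),
    fun hx => (h'.nArr hx).trans (h.nArr hx), fun hx => (h'.rArr hx).trans (h.rArr hx)⟩

theorem Frame.mono {P Q : Prog} {s s' : Store} (h : Frame P s s') (h1 : P.nRegs ⊆ Q.nRegs)
    (h2 : P.rRegs ⊆ Q.rRegs) (h3 : P.nArrs ⊆ Q.nArrs) (h4 : P.rArrs ⊆ Q.rArrs) : Frame Q s s' :=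
  ⟨fun hx => h.nReg fun h' => hx (h1 h'), fun hx => h.rReg fun h' => hx (h2 h'),
    fun hx => h.nArr fun h' => hx (h3 h'), fun hx => h.rArr fun h' => hx (h4 h')⟩

theorem put_of_ne {α : Type} (f : ℕ → ℕ → ℕ → α) {a b : ℕ} (i j : ℕ) (v : α) (h : b ≠ a) :
    put f a i j v b = f b := by simp [put, h]

theorem Exec.frame {P : Prog} {s s' : Store} {t : ℕ} (h : Exec P s s' t) : Frame P s s' := by
  induction h with
  | skip s => exact .refl _ _
  | nSet s x e =>
    exact ⟨fun h => Function.update_of_ne (by simpa [Prog.nRegs] using h) _ _, fun _ => rfl,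
      fun _ => rfl, fun _ => rfl⟩
  | rSet s x e =>
    exact ⟨fun _ => rfl, fun h => Function.update_of_ne (by simpa [Prog.rRegs] using h) _ _,
      fun _ => rfl, fun _ => rfl⟩
  | nPut s a i j e =>
    exact ⟨fun _ => rfl, fun _ => rfl,
      fun h => put_of_ne _ _ _ _ (by simpa [Prog.nArrs] using h), fun _ => rfl⟩
  | rPut s a i j e =>
    exact ⟨fun _ => rfl, fun _ => rfl, fun _ => rfl,
      fun h => put_of_ne _ _ _ _ (by simpa [Prog.rArrs] using h)⟩
  | seq P Q _ _ _ _ _ _ _ ih1 ih2 =>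
    refine (ih1.mono ?_ ?_ ?_ ?_).trans (ih2.mono ?_ ?_ ?_ ?_) <;>
      simp [Prog.nRegs, Prog.rRegs, Prog.nArrs, Prog.rArrs]
  | iteTrue b P Q _ _ _ _ _ ih =>
    refine ih.mono ?_ ?_ ?_ ?_ <;> simp [Prog.nRegs, Prog.rRegs, Prog.nArrs, Prog.rArrs]
  | iteFalse b P Q _ _ _ _ _ ih =>
    refine ih.mono ?_ ?_ ?_ ?_ <;> simp [Prog.nRegs, Prog.rRegs, Prog.nArrs, Prog.rArrs]
  | loopDone => exact .refl _ _
  | loopStep b P _ _ _ _ _ _ _ _ ih1 ih2 =>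
    exact (ih1.mono (Q := .loop b P) (fun _ h => h) (fun _ h => h) (fun _ h => h)
      (fun _ h => h)).trans ih2

/-- Started in `s`, the program `P` halts after at most `T` steps in a memory with property `Q`. -/
def Runs (P : Prog) (s : Store) (T : ℕ) (Q : Store → Prop) : Prop :=
  ∃ s' t, Exec P s s' t ∧ t ≤ T ∧ Q s'

theorem Runs.mono {P : Prog} {s : Store} {T T' : ℕ} {Q Q' : Store → Prop} (h : Runs P s T Q)
    (hT : T ≤ T') (hQ : ∀ s', Frame P s s' → Q s' → Q' s') : Runs P s T' Q' := by
  obtain ⟨s', t, h1, h2, h3⟩ := h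
  exact ⟨s', t, h1, h2.trans hT, hQ s' h1.frame h3⟩

theorem Runs.seq {P P' : Prog} {s : Store} {T T' : ℕ} {Q R : Store → Prop} (h : Runs P s T R)
    (h' : ∀ s', Frame P s s' → R s' → Runs P' s' T' Q) : Runs (.seq P P') s (T + T') Q := by
  obtain ⟨s', t, h1, h2, h3⟩ := h
  obtain ⟨s'', t', h4, h5, h6⟩ := h' s' h1.frame h3
  exact ⟨s'', t + t', .seq _ _ _ _ _ _ _ h1 h4, by omega, h6⟩

theorem Runs.ite {b : Test} {P P' : Prog} {s : Store} {T T' : ℕ} {Q : Store → Prop}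
    (h : b.holds s → Runs P s T Q) (h' : ¬ b.holds s → Runs P' s T Q) (hT : b.cost + T + 1 ≤ T') :
    Runs (.ite b P P') s T' Q := by
  by_cases hb : b.holds s
  · obtain ⟨s', t, h1, h2, h3⟩ := h hb
    exact ⟨s', _, .iteTrue _ _ _ _ _ _ hb h1, by omega, h3⟩
  · obtain ⟨s', t, h1, h2, h3⟩ := h' hb
    exact ⟨s', _, .iteFalse _ _ _ _ _ _ hb h1, by omega, h3⟩

theorem Runs.of_wp_bound {P : Prog} {s : Store} {Q : Store → Prop} (h : P.wp Q s) :
    Runs P s P.bound Q := by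
  induction P generalizing s Q with
  | skip => exact ⟨_, _, .skip s, le_rfl, h⟩
  | nSet x e => exact ⟨_, _, .nSet s x e, le_rfl, h⟩
  | rSet x e => exact ⟨_, _, .rSet s x e, le_rfl, h⟩
  | nPut a i j e => exact ⟨_, _, .nPut s a i j e, le_rfl, h⟩
  | rPut a i j e => exact ⟨_, _, .rPut s a i j e, le_rfl, h⟩
  | seq P P' ih ih' => exact (ih h).seq fun s' _ hs' => ih' hs'
  | ite b P P' ih ih' =>
    refine Runs.ite (T := max P.bound P'.bound) (fun hb => ?_) (fun hb => ?_) le_rfl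
    · exact (ih (h.1 hb)).mono (le_max_left _ _) fun _ _ h => h
    · exact (ih' (h.2 hb)).mono (le_max_right _ _) fun _ _ h => h
  | loop b P => exact h.elim

theorem Runs.of_wp {P : Prog} {s : Store} {T : ℕ} {Q : Store → Prop} (hT : P.bound ≤ T)
    (h : P.wp Q s) : Runs P s T Q :=
  (Runs.of_wp_bound h).mono hT fun _ _ h => h

/-- Run `P` with the index register `x` counting from `0` to one less than the value of the index
register `y`. -/
def forLoop (x y : ℕ) (P : Prog) : Prog :=
  .seq (.nSet x (.const 0))
    (.loop (.neg (.nLe (.reg y) (.reg x))) (.seq P (.nSet x (.add (.reg x) (.const 1)))))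

theorem Runs.forLoop {x y : ℕ} {P : Prog} {s : Store} {T T' : ℕ} {Q : Store → Prop}
    (I : ℕ → Store → Prop) (hxy : y ≠ x) (hx : x ∉ P.nRegs) (hy : y ∉ P.nRegs)
    (h0 : I 0 (s.setN x 0))
    (hstep : ∀ i < s.nReg y, ∀ s', Frame (RealRAM.forLoop x y P) s s' → s'.nReg x = i → I i s' →
      Runs P s' T fun s'' => I (i + 1) (s''.setN x (i + 1)))
    (hend : ∀ s', Frame (RealRAM.forLoop x y P) s s' → I (s.nReg y) s' → Q s')
    (hT : s.nReg y * (T + 9) + 7 ≤ T') : Runs (RealRAM.forLoop x y P) s T' Q := by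
  set F := RealRAM.forLoop x y P with hF
  have key : ∀ d i s', i + d = s.nReg y → Frame F s s' → s'.nReg x = i → I i s' →
      Runs (.loop (.neg (.nLe (.reg y) (.reg x))) (.seq P (.nSet x (.add (.reg x) (.const 1)))))
        s' (d * (T + 9) + 5) Q := by
    have hyF : y ∉ F.nRegs := by
      simp [hF, RealRAM.forLoop, Prog.nRegs, hxy, hy]
    intro d
    induction d with
    | zero =>
      intro i s' hi hfr hxi hI
      refine ⟨s', _, .loopDone _ _ _ ?_, ?_, hend s' hfr (by rwa [← hi])⟩
      · simp only [Test.holds, NExp.eval, not_not]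
        rw [hfr.nReg hyF, hxi]
        omega
      · simp [Test.cost, NExp.cost]
    | succ d ih =>
      intro i s' hi hfr hxi hI
      obtain ⟨s1, t1, he1, ht1, hI1⟩ := hstep i (by omega) s' hfr hxi hI
      have hx1 : s1.nReg x = i := (he1.frame.nReg hx).trans hxi
      have hexec : Exec (.seq P (.nSet x (.add (.reg x) (.const 1)))) s' (s1.setN x (i + 1))
          (t1 + 4) := by
        have := Exec.nSet s1 x (.add (.reg x) (.const 1))
        rw [show (NExp.add (.reg x) (.const 1)).eval s1 = i + 1 by simp [NExp.eval, hx1]] at this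
        exact .seq _ _ _ _ _ _ _ he1 this
      have hfr' : Frame F s' (s1.setN x (i + 1)) := by
        refine hexec.frame.mono ?_ ?_ ?_ ?_ <;>
          simp [hF, RealRAM.forLoop, Prog.nRegs, Prog.rRegs, Prog.nArrs, Prog.rArrs]
      obtain ⟨s2, t2, he2, ht2, hQ⟩ := ih (i + 1) (s1.setN x (i + 1)) (by omega)
        (hfr.trans hfr') (by simp) hI1
      refine ⟨s2, _, .loopStep _ _ _ _ _ _ _ ?_ hexec he2, ?_, hQ⟩
      · simp only [Test.holds, NExp.eval]
        rw [hfr.nReg hyF, hxi]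
        omega
      · simp only [Test.cost, NExp.cost]
        rw [Nat.succ_mul]
        omega
  have hfr0 : Frame F s (s.setN x 0) := by
    refine (Exec.nSet s x (.const 0)).frame.mono ?_ ?_ ?_ ?_ <;>
      simp [hF, RealRAM.forLoop, Prog.nRegs, Prog.rRegs, Prog.nArrs, Prog.rArrs]
  obtain ⟨s2, t2, he2, ht2, hQ⟩ := key (s.nReg y) 0 (s.setN x 0) (by omega) hfr0 (by simp) h0
  refine ⟨s2, _, .seq _ _ _ _ _ _ _ (.nSet s x (.const 0)) he2, ?_, hQ⟩
  simp only [NExp.cost]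
  omega

/-- The sum of the first `k` values of `f`. -/
def partialSum {n : ℕ} (f : Fin n → ℕ) (k : ℕ) : ℕ := ∑ i : Fin n, if (i : ℕ) < k then f i else 0

@[simp] theorem partialSum_zero {n : ℕ} (f : Fin n → ℕ) : partialSum f 0 = 0 := by
  simp [partialSum]

theorem partialSum_succ {n : ℕ} (f : Fin n → ℕ) (k : Fin n) :
    partialSum f (k + 1) = partialSum f k + f k := by
  have h : f k = ∑ i, if i = k then f i else 0 := by simp
  rw [h, partialSum, partialSum, ← Finset.sum_add_distrib]
  refine Finset.sum_congr rfl fun i _ => ?_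
  have : i = k ↔ (i : ℕ) = k := Fin.ext_iff
  split_ifs <;> omega

theorem partialSum_self {n : ℕ} (f : Fin n → ℕ) : partialSum f n = ∑ i, f i := by
  simp [partialSum]

open LayeredLS

/-! ### The threshold -/

/-- Put `n` and `γ / n` into the real registers `1` and `2`. -/
def thresholdProg : Prog :=
  .seq (.rSet 1 (.const 0)) (.seq (forLoop 3 0 (.rSet 1 (.add (.reg 1) (.const 1))))
    (.rSet 2 (.div (.div (.reg 0) (.mul (.const 1024)
      (.mul (.reg 1) (.mul (.reg 1) (.mul (.reg 1) (.mul (.reg 1) (.reg 1))))))) (.reg 1))))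

theorem thresholdProg_runs {n : ℕ} {β : ℝ} {s : Store} (hn : s.nReg 0 = n) (hβ : s.rReg 0 = β) :
    Runs thresholdProg s (n * 20 + 50) fun s' => s'.rReg 2 = gam n β / n := by
  refine ((Runs.of_wp_bound (P := .rSet 1 (.const 0)) (Q := fun s' => s'.rReg 1 = 0)
    (by simp [Prog.wp, RExp.eval])).seq (T' := n * 20 + 40) fun s1 hf1 h1 => ?_).mono
    (by simp [Prog.bound, RExp.cost]; omega) fun _ _ h => h
  have hn1 : s1.nReg 0 = n := (hf1.nReg (by decide)).trans hn
  have hloop : Runs (forLoop 3 0 (.rSet 1 (.add (.reg 1) (.const 1)))) s1 (n * 15 + 7)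
      fun s' => s'.rReg 1 = n := by
    refine Runs.forLoop (T := 4) (fun i s' => s'.rReg 1 = i) (by decide) (by decide) (by decide)
      (by simp [h1]) (fun i _ s' _ _ hI => ?_) (fun s' _ hI => ?_) (by rw [hn1]; omega)
    · exact Runs.of_wp (by decide) (by simp [Prog.wp, RExp.eval, hI])
    · rw [hI, hn1]
  refine (hloop.seq (T' := 30) fun s2 hf2 h2 => Runs.of_wp (by decide) ?_).mono (by omega)
    fun _ _ h => h
  have hβ2 : s2.rReg 0 = β := (hf2.rReg (by decide)).trans ((hf1.rReg (by decide)).trans hβ)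
  simp [Prog.wp, RExp.eval, h2, hβ2, gam]
  ring

/-! ### The digraph of the estimates -/

open Classical in
/-- The index array `1` holds the adjacency matrix of `E`. -/
def HoldsGraph {n : ℕ} (s : Store) (E : Fin n → Fin n → Prop) : Prop :=
  ∀ i j : Fin n, s.nArr 1 i j = if E i j then 1 else 0

/-- Build the adjacency matrix of the digraph of the estimates in the index array `1`. -/
def graphProg : Prog :=
  forLoop 3 0 (forLoop 4 0
    (.ite (.conj (.neg (.conj (.nLe (.reg 3) (.reg 4)) (.nLe (.reg 4) (.reg 3))))
        (.rLe (.reg 2) (.div (.mul (.get 2 (.reg 3) (.reg 4)) (.get 1 (.reg 4) (.const 0)))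
          (.get 1 (.reg 3) (.const 0)))))
      (.nPut 1 (.reg 3) (.reg 4) (.const 1)) (.nPut 1 (.reg 3) (.reg 4) (.const 0))))

theorem graphProg_runs {n : ℕ} {δ : Fin n → ℝ} {κh : Fin n → Fin n → ℝ} {s : Store}
    (hn : s.nReg 0 = n) (hδ : ∀ i : Fin n, s.rArr 1 i 0 = δ i)
    (hκ : ∀ i j : Fin n, s.rArr 2 i j = κh i j) :
    Runs graphProg s (n * (n * 40 + 16) + 7) fun s' =>
      HoldsGraph s' (estGraph κh δ (s.rReg 2)) := by
  classical
  refine Runs.forLoop (T := n * 40 + 7) (fun i s' => ∀ a b : Fin n, (a : ℕ) < i →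
    s'.nArr 1 a b = if estGraph κh δ (s.rReg 2) a b then 1 else 0)
    (by decide) (by decide) (by decide) (by simp) ?_ ?_ (by rw [hn])
  · intro i hi s1 hf1 hi1 hI1
    rw [hn] at hi
    lift i to Fin n using hi
    have hn1 : s1.nReg 0 = n := (hf1.nReg (by decide)).trans hn
    refine Runs.forLoop (T := 30) (fun j s' => ∀ a b : Fin n, (a : ℕ) < i ∨ (a = i ∧ (b : ℕ) < j) →
      s'.nArr 1 a b = if estGraph κh δ (s.rReg 2) a b then 1 else 0)
      (by decide) (by decide) (by decide) (by simpa using hI1) ?_ ?_ (by rw [hn1]; omega)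
    · intro j hj s2 hf2 hj2 hI2
      rw [hn1] at hj
      lift j to Fin n using hj
      have hi2 : s2.nReg 3 = i := (hf2.nReg (by decide)).trans hi1
      have hσ : s2.rReg 2 = s.rReg 2 := (hf2.rReg (by decide)).trans (hf1.rReg (by decide))
      have hr2 : ∀ a, s2.rArr a = s.rArr a := fun a =>
        (hf2.rArr (by simp [forLoop, Prog.rArrs])).trans
          (hf1.rArr (by simp [forLoop, Prog.rArrs]))
      have hiff : (estGraph κh δ (s.rReg 2) i j) ↔
          (¬((i : ℕ) ≤ j ∧ (j : ℕ) ≤ i) ∧ s.rReg 2 ≤ κh i j * δ j / δ i) := by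
        rw [estGraph]
        refine and_congr_left fun _ => ?_
        rw [← le_antisymm_iff, Fin.val_inj]
      have hfin : ∀ v, (v = if estGraph κh δ (s.rReg 2) i j then 1 else 0) →
          ∀ a b : Fin n, (a : ℕ) < i ∨ (a = i ∧ (b : ℕ) < j + 1) →
          (if (a : ℕ) = i ∧ (b : ℕ) = j then v else s2.nArr 1 a b) =
            if estGraph κh δ (s.rReg 2) a b then 1 else 0 := by
        intro v hv a b hab
        by_cases h : (a : ℕ) = i ∧ (b : ℕ) = j
        · rw [if_pos h, hv, Fin.ext h.1, Fin.ext h.2]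
        · rw [if_neg h]
          refine hI2 a b ?_
          rw [Fin.ext_iff] at hab ⊢
          omega
      refine Runs.of_wp (by decide) ?_
      simp only [Prog.wp, Test.holds, NExp.eval, RExp.eval, hi2, hj2, hσ, hr2, hδ, hκ, ← hiff,
        Store.putN_nArr, Store.setN_nArr, true_and]
      exact ⟨fun h => hfin 1 (by rw [if_pos h]), fun h => hfin 0 (by rw [if_neg h])⟩
    · intro s2 hf2 hI2 a b hab
      rw [hn1] at hI2
      refine hI2 a b ?_
      rw [Fin.ext_iff]
      omega
  · intro s1 hf1 hI1 a b
    rw [hn] at hI1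
    exact hI1 a b a.2

/-! ### Strongly connected components -/

/-- Compute the out-degrees and in-degrees in the index arrays `2` and `3`. -/
def degreeProg : Prog :=
  forLoop 3 0 (.seq (.nSet 5 (.const 0)) (.seq (.nSet 6 (.const 0)) (.seq
    (forLoop 4 0 (.seq (.nSet 5 (.add (.reg 5) (.get 1 (.reg 3) (.reg 4))))
      (.nSet 6 (.add (.reg 6) (.get 1 (.reg 4) (.reg 3))))))
    (.seq (.nPut 2 (.reg 3) (.const 0) (.reg 5)) (.nPut 3 (.reg 3) (.const 0) (.reg 6))))))

/-- The index arrays `2` and `3` hold the degrees of the digraph `E`. -/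
def HoldsDegrees {n : ℕ} (s : Store) (E : Fin n → Fin n → Prop) : Prop :=
  ∀ i : Fin n, s.nArr 2 i 0 = outDeg E i ∧ s.nArr 3 i 0 = inDeg E i

theorem degreeProg_runs {n : ℕ} {E : Fin n → Fin n → Prop} {s : Store} (hn : s.nReg 0 = n)
    (hE : HoldsGraph s E) :
    Runs degreeProg s (n * (n * 40 + 50) + 7) fun s' => HoldsDegrees s' E := by
  classical
  refine Runs.forLoop (T := n * 40 + 40) (fun k s' => ∀ i : Fin n, (i : ℕ) < k →
    s'.nArr 2 i 0 = outDeg E i ∧ s'.nArr 3 i 0 = inDeg E i)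
    (by decide) (by decide) (by decide) (by simp) ?_ ?_ (by rw [hn]; nlinarith)
  · intro i hi s1 hf1 hi1 hI1
    rw [hn] at hi
    lift i to Fin n using hi
    have hn1 : s1.nReg 0 = n := (hf1.nReg (by decide)).trans hn
    refine ((Runs.of_wp (T := 2) (Q := fun s' => s'.nReg 5 = 0) (by decide)
      (by simp [Prog.wp, NExp.eval])).seq (T' := n * 40 + 30) fun s2 hf2 h2 => ?_).mono (by omega)
      fun _ _ h => h
    refine ((Runs.of_wp (T := 2) (Q := fun s' => s'.nReg 6 = 0) (by decide)
      (by simp [Prog.wp, NExp.eval])).seq (T' := n * 40 + 20) fun s3 hf3 h3 => ?_).mono (by omega)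
      fun _ _ h => h
    have hn3 : s3.nReg 0 = n := (hf3.nReg (by decide)).trans ((hf2.nReg (by decide)).trans hn1)
    have hi3 : s3.nReg 3 = i := (hf3.nReg (by decide)).trans ((hf2.nReg (by decide)).trans hi1)
    have h53 : s3.nReg 5 = 0 := (hf3.nReg (by decide)).trans h2
    have hA3 : s3.nArr = s1.nArr := funext fun a => (hf3.nArr (by simp [Prog.nArrs])).trans
      (hf2.nArr (by simp [Prog.nArrs]))
    have hG : ∀ i j : Fin n, s3.nArr 1 i j = if E i j then 1 else 0 := fun i j => by
      rw [hA3, hf1.nArr (by decide), hE]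
    have hloop : Runs (forLoop 4 0 (.seq (.nSet 5 (.add (.reg 5) (.get 1 (.reg 3) (.reg 4))))
      (.nSet 6 (.add (.reg 6) (.get 1 (.reg 4) (.reg 3)))))) s3 (n * 40 + 7)
      fun s' => s'.nReg 5 = outDeg E i ∧ s'.nReg 6 = inDeg E i := by
      refine Runs.forLoop (T := 20) (fun j s' =>
        s'.nReg 5 = partialSum (fun j => if E i j then 1 else 0) j ∧
        s'.nReg 6 = partialSum (fun j => if E j i then 1 else 0) j)
        (by decide) (by decide) (by decide) (by simp [h3, h53]) ?_ ?_ (by rw [hn3]; omega)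
      · intro j hj s4 hf4 hj4 hI4
        rw [hn3] at hj
        lift j to Fin n using hj
        have hi4 : s4.nReg 3 = i := (hf4.nReg (by decide)).trans hi3
        refine Runs.of_wp (by decide) ?_
        simp [Prog.wp, NExp.eval, hi4, hj4, hI4, hf4.nArr (a := 1) (by decide), hG,
          partialSum_succ]
      · intro s4 _ hI4
        rw [hn3, partialSum_self, partialSum_self] at hI4
        rw [outDeg, inDeg, Finset.card_filter, Finset.card_filter]
        exact hI4
    refine (hloop.seq (T' := 13) fun s4 hf4 h4 => Runs.of_wp (by decide) ?_).mono (by omega)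
      fun _ _ h => h
    have hi4 : s4.nReg 3 = i := (hf4.nReg (by decide)).trans hi3
    have hA4 : s4.nArr = s1.nArr := (funext fun a =>
      hf4.nArr (by simp [forLoop, Prog.nArrs])).trans hA3
    simp only [Prog.wp, NExp.eval, hi4, h4, Store.putN_nArr, Store.putN_nReg, Store.setN_nArr, hA4]
    intro a ha
    by_cases hai : a = i
    · subst hai; simp
    · have hai : (a : ℕ) ≠ i := fun h => hai (Fin.ext h)
      have := hI1 a (by omega)
      simp [hai, this]
  · intro s1 _ hI1 i
    rw [hn] at hI1
    exact hI1 i i.2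

/-- For the threshold in the index register `3`, compute the number of vertices of low in-degree and
the two degree sums that decide whether they form a cut. -/
def cutSumProg : Prog :=
  .seq (.nSet 5 (.const 0)) (.seq (.nSet 6 (.const 0)) (.seq (.nSet 7 (.const 0))
    (forLoop 4 0 (.ite (.nLe (.get 3 (.reg 4) (.const 0)) (.reg 3))
      (.seq (.nSet 5 (.add (.reg 5) (.const 1)))
        (.seq (.nSet 6 (.add (.reg 6) (.get 2 (.reg 4) (.const 0))))
          (.nSet 7 (.add (.reg 7) (.add (.get 3 (.reg 4) (.const 0))
            (.sub (.reg 0) (.add (.reg 3) (.const 1))))))))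
      .skip))))

theorem cutSumProg_runs {n k : ℕ} {E : Fin n → Fin n → Prop} {s : Store} (hn : s.nReg 0 = n)
    (hk : s.nReg 3 = k) (hE : HoldsDegrees s E) :
    Runs cutSumProg s (n * 50 + 20) fun s' => s'.nReg 5 = (lowSet E k).card ∧
      s'.nReg 6 = ∑ i ∈ lowSet E k, outDeg E i ∧
      s'.nReg 7 = ∑ i ∈ lowSet E k, (inDeg E i + (n - (k + 1))) := by
  classical
  refine ((Runs.of_wp (T := 2) (Q := fun s' => s'.nReg 5 = 0) (by decide)
    (by simp [Prog.wp, NExp.eval])).seq (T' := n * 50 + 15) fun s1 hf1 h1 => ?_).mono (by omega)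
    fun _ _ h => h
  refine ((Runs.of_wp (T := 2) (Q := fun s' => s'.nReg 6 = 0) (by decide)
    (by simp [Prog.wp, NExp.eval])).seq (T' := n * 50 + 12) fun s2 hf2 h2 => ?_).mono (by omega)
    fun _ _ h => h
  refine ((Runs.of_wp (T := 2) (Q := fun s' => s'.nReg 7 = 0) (by decide)
    (by simp [Prog.wp, NExp.eval])).seq (T' := n * 50 + 10) fun s3 hf3 h3 => ?_).mono (by omega)
    fun _ _ h => h
  have hreg : ∀ x, x ≠ 5 → x ≠ 6 → x ≠ 7 → s3.nReg x = s.nReg x := fun x h5 h6 h7 =>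
    (hf3.nReg (by simp [Prog.nRegs, h7])).trans ((hf2.nReg (by simp [Prog.nRegs, h6])).trans
      (hf1.nReg (by simp [Prog.nRegs, h5])))
  have hA3 : s3.nArr = s.nArr := funext fun a => (hf3.nArr (by simp [Prog.nArrs])).trans
    ((hf2.nArr (by simp [Prog.nArrs])).trans (hf1.nArr (by simp [Prog.nArrs])))
  have hn3 : s3.nReg 0 = n := (hreg 0 (by simp) (by simp) (by simp)).trans hn
  have hk3 : s3.nReg 3 = k := (hreg 3 (by simp) (by simp) (by simp)).trans hk
  have h53 : s3.nReg 5 = 0 := (hf3.nReg (by decide)).trans ((hf2.nReg (by decide)).trans h1)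
  have h63 : s3.nReg 6 = 0 := (hf3.nReg (by decide)).trans h2
  refine Runs.forLoop (T := 40) (fun j s' =>
    s'.nReg 5 = partialSum (fun i => if inDeg E i ≤ k then 1 else 0) j ∧
    s'.nReg 6 = partialSum (fun i => if inDeg E i ≤ k then outDeg E i else 0) j ∧
    s'.nReg 7 = partialSum (fun i => if inDeg E i ≤ k then inDeg E i + (n - (k + 1)) else 0) j)
    (by decide) (by decide) (by decide) (by simp [h3, h53, h63]) ?_ ?_ (by rw [hn3]; omega)
  · intro j hj s4 hf4 hj4 hI4
    rw [hn3] at hj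
    lift j to Fin n using hj
    have hk4 : s4.nReg 3 = k := (hf4.nReg (by decide)).trans hk3
    have hn4 : s4.nReg 0 = n := (hf4.nReg (by decide)).trans hn3
    have hA4 : s4.nArr = s.nArr := (funext fun a =>
      hf4.nArr (by simp [forLoop, Prog.nArrs])).trans hA3
    refine Runs.of_wp (by decide) ?_
    simp only [Prog.wp, Test.holds, NExp.eval, hk4, hj4, hA4, (hE j).2]
    constructor
    · intro h
      simp [hI4, hj4, hk4, hn4, hA4, (hE j).1, (hE j).2, partialSum_succ, h]
    · intro h
      simp [hI4, partialSum_succ, h]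
  · intro s4 _ hI4
    simp only [hn3, partialSum_self] at hI4
    rw [lowSet, Finset.card_filter, Finset.sum_filter, Finset.sum_filter]
    exact hI4

/-- Increase the layer numbers of all vertices beyond the cut. -/
def bumpProg : Prog :=
  forLoop 4 0 (.ite (.neg (.nLe (.get 3 (.reg 4) (.const 0)) (.reg 3)))
    (.nPut 0 (.reg 4) (.const 0) (.add (.get 0 (.reg 4) (.const 0)) (.const 1))) .skip)

theorem bumpProg_runs {n k : ℕ} {E : Fin n → Fin n → Prop} {s : Store} (hn : s.nReg 0 = n)
    (hk : s.nReg 3 = k) (hE : HoldsDegrees s E) :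
    Runs bumpProg s (n * 40 + 7) fun s' => ∀ i : Fin n,
      s'.nArr 0 i 0 = s.nArr 0 i 0 + if k < inDeg E i then 1 else 0 := by
  refine Runs.forLoop (T := 30) (fun j s' => ∀ i : Fin n,
    s'.nArr 0 i 0 = s.nArr 0 i 0 + if (i : ℕ) < j ∧ k < inDeg E i then 1 else 0)
    (by decide) (by decide) (by decide) (by simp) ?_ ?_ (by rw [hn]; omega)
  · intro j hj s1 hf1 hj1 hI1
    rw [hn] at hj
    lift j to Fin n using hj
    have hk1 : s1.nReg 3 = k := (hf1.nReg (by decide)).trans hk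
    have hA : s1.nArr 3 = s.nArr 3 := hf1.nArr (by decide)
    refine Runs.of_wp (by decide) ?_
    simp only [Prog.wp, Test.holds, NExp.eval, hk1, hj1, hA, (hE j).2, Store.putN_nArr,
      Store.setN_nArr, hI1]
    constructor <;> intro h i <;> by_cases hij : i = j
    · subst hij
      simp [not_le.1 h]
    · have hij : (i : ℕ) ≠ j := fun h => hij (Fin.ext h)
      simp only [hij, and_false, false_and, if_false]
      congr 2
      rw [eq_iff_iff]
      omega
    · subst hij
      simp only [not_not] at h
      simp [h]
    · have hij : (i : ℕ) ≠ j := fun h => hij (Fin.ext h)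
      congr 2
      rw [eq_iff_iff]
      omega
  · intro s1 _ hI1 i
    rw [hn] at hI1
    simpa using hI1 i

/-- Set all layer numbers to `0`. -/
def clearProg : Prog := forLoop 3 0 (.nPut 0 (.reg 3) (.const 0) (.const 0))

/-- Compute the strongly connected components of a semicomplete digraph. -/
def sccProg : Prog :=
  .seq degreeProg (.seq clearProg (.seq (.nSet 2 (.const 0))
    (forLoop 3 0 (.seq cutSumProg
      (.ite (.conj (.nLe (.reg 5) (.add (.reg 3) (.const 1)))
          (.conj (.nLe (.add (.reg 3) (.const 1)) (.reg 5))
            (.conj (.nLe (.reg 6) (.reg 7)) (.nLe (.reg 7) (.reg 6)))))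
        (.seq (.nSet 2 (.add (.reg 2) (.const 1))) bumpProg) .skip)))))

/-- The number of layers is in the index register `2` and the layer numbers are in the index
array `0`. -/
def HoldsLayering {n : ℕ} (s : Store) (J : Layering n) : Prop :=
  s.nReg 2 = J.p ∧ ∀ i : Fin n, s.nArr 0 i 0 = (J.layer i : ℕ)

theorem sccProg_runs {n : ℕ} {E : Fin n → Fin n → Prop} (hE : IsSemicomplete E) (hpos : 0 < n)
    {s : Store} (hn : s.nReg 0 = n) (hG : HoldsGraph s E) :
    Runs sccProg s (n * (n * 200 + 200) + 50) fun s' => HoldsLayering s' (sccLayering hE hpos) := by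
  classical
  refine ((degreeProg_runs hn hG).seq (T' := n * (n * 160 + 150) + 43)
    fun s1 hf1 h1 => ?_).mono (by nlinarith) fun _ _ h => h
  have hn1 : s1.nReg 0 = n := (hf1.nReg (by decide)).trans hn
  have hclear : Runs clearProg s1 (n * 20 + 7) fun s' => ∀ i : Fin n, s'.nArr 0 i 0 = 0 := by
    refine Runs.forLoop (T := 5) (fun j s' => ∀ i : Fin n, (i : ℕ) < j → s'.nArr 0 i 0 = 0)
      (by decide) (by decide) (by decide) (by simp) ?_ ?_ (by rw [hn1]; omega)
    · intro j hj s2 hf2 hj2 hI2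
      refine Runs.of_wp (by decide) ?_
      simp only [Prog.wp, NExp.eval, hj2, Store.putN_nArr, Store.setN_nArr]
      intro i hi
      by_cases hij : (i : ℕ) = j
      · simp [hij]
      · simp [hij, hI2 i (by omega)]
    · intro s2 _ hI2 i
      rw [hn1] at hI2
      exact hI2 i i.2
  refine (hclear.seq (T' := n * (n * 160 + 120) + 30) fun s2 hf2 h2 => ?_).mono (by nlinarith)
    fun _ _ h => h
  refine ((Runs.of_wp (T := 2) (Q := fun s' => s'.nReg 2 = 0) (by decide)
    (by simp [Prog.wp, NExp.eval])).seq (T' := n * (n * 160 + 120) + 20)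
    fun s3 hf3 h3 => ?_).mono (by omega) fun _ _ h => h
  have hn3 : s3.nReg 0 = n := (hf3.nReg (by decide)).trans ((hf2.nReg (by decide)).trans hn1)
  have hD3 : HoldsDegrees s3 E := fun i => by
    rw [hf3.nArr (by decide), hf2.nArr (by decide), hf3.nArr (by decide), hf2.nArr (by decide)]
    exact h1 i
  have hL3 : ∀ i : Fin n, s3.nArr 0 i 0 = 0 := fun i => by rw [hf3.nArr (by decide), h2]
  refine Runs.forLoop (T := n * 160 + 100) (fun k s' => s'.nReg 2 = Nat.count (IsCut E) k ∧
    ∀ i : Fin n, s'.nArr 0 i 0 = Nat.count (IsCut E) (min k (inDeg E i)))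
    (by decide) (by decide) (by decide) (by simp [h3, hL3]) ?_ ?_ (by rw [hn3]; nlinarith)
  · intro k hk s4 hf4 hk4 hI4
    have hn4 : s4.nReg 0 = n := (hf4.nReg (by decide)).trans hn3
    have hD4 : HoldsDegrees s4 E := fun i => by
      rw [hf4.nArr (by decide), hf4.nArr (by decide)]
      exact hD3 i
    have hmin : ∀ i, Nat.count (IsCut E) (min (k + 1) (inDeg E i)) =
        Nat.count (IsCut E) (min k (inDeg E i)) +
          if IsCut E k ∧ k < inDeg E i then 1 else 0 := by
      intro i
      by_cases h : k < inDeg E i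
      · rw [min_eq_left h, min_eq_left h.le, Nat.count_succ]
        simp [h]
      · rw [min_eq_right (by omega), min_eq_right (by omega)]
        simp [h]
    refine ((cutSumProg_runs hn4 hk4 hD4).seq (T' := n * 50 + 60) fun s5 hf5 h5 => ?_).mono
      (by omega) fun _ _ h => h
    have hk5 : s5.nReg 3 = k := (hf5.nReg (by decide)).trans hk4
    have h25 : s5.nReg 2 = s4.nReg 2 := hf5.nReg (by decide)
    have hA5 : s5.nArr = s4.nArr := funext fun a => hf5.nArr (by simp [cutSumProg, forLoop, Prog.nArrs])
    have hiff : (Test.conj (.nLe (.reg 5) (.add (.reg 3) (.const 1)))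
          (.conj (.nLe (.add (.reg 3) (.const 1)) (.reg 5))
            (.conj (.nLe (.reg 6) (.reg 7)) (.nLe (.reg 7) (.reg 6))))).holds s5 ↔ IsCut E k := by
      rw [isCut_iff_sum]
      simp only [Test.holds, NExp.eval, hk5, h5]
      rw [← and_assoc, ← le_antisymm_iff, ← le_antisymm_iff]
    refine Runs.ite (T := n * 50 + 30) (fun h => ?_) (fun h => ?_)
      (by simp [Test.cost, NExp.cost]; omega)
    · rw [hiff] at h
      refine ((Runs.of_wp (T := 4) (Q := fun s' => s'.nReg 2 = s5.nReg 2 + 1) (by decide)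
        (by simp [Prog.wp, NExp.eval])).seq (T' := n * 50 + 20) fun s6 hf6 h6 => ?_).mono
        (by omega) fun _ _ h => h
      have hD6 : HoldsDegrees s6 E := fun i => by
        rw [hf6.nArr (by decide), hf6.nArr (by decide), hA5]
        exact hD4 i
      refine (bumpProg_runs ((hf6.nReg (by decide)).trans ((hf5.nReg (by decide)).trans hn4))
        ((hf6.nReg (by decide)).trans hk5) hD6).mono (by omega) fun s7 hf7 h7 => ?_
      simp only [Store.setN_nReg, Store.setN_nArr, Nat.reduceEqDiff, if_false]
      refine ⟨?_, fun i => ?_⟩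
      · rw [hf7.nReg (by decide), h6, h25, hI4.1, Nat.count_succ, if_pos h]
      · rw [h7, hf6.nArr (by decide), hA5, hI4.2, hmin]
        simp [h]
    · rw [hiff] at h
      refine Runs.of_wp (by simp [Prog.bound]) ?_
      simp only [Prog.wp, Store.setN_nReg, Store.setN_nArr, hA5, hmin, Nat.count_succ, h]
      simpa [h25] using hI4
  · intro s4 _ hI4
    rw [hn3] at hI4
    refine ⟨hI4.1, fun i => ?_⟩
    rw [hI4.2, min_eq_right (inDeg_lt hE i).le]
    rfl

/-! ### Gauss–Jordan elimination -/

/-- The real array `0` holds the matrix `T`. -/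
def HoldsMatrix {m n : ℕ} (s : Store) (T : Fin m → Fin n → ℝ) : Prop :=
  ∀ (q : Fin m) (j : Fin n), s.rArr 0 q j = T q j

/-- The index array `0` holds the numbers `w i < n`, and `n` in position `n`. -/
structure HoldsWeights {n : ℕ} (s : Store) (w : Fin n → ℕ) : Prop where
  eq : ∀ i : Fin n, s.nArr 0 i 0 = w i
  lt : ∀ i, w i < n
  last : s.nArr 0 n 0 = n

theorem HoldsWeights.congr {n : ℕ} {s s' : Store} {w : Fin n → ℕ} (h : HoldsWeights s w)
    (hs : s'.nArr 0 = s.nArr 0) : HoldsWeights s' w :=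
  ⟨fun i => by rw [hs, h.eq], h.lt, by rw [hs, h.last]⟩

/-- Find the nonzero entry of minimal weight in the row given by the index register `3`. -/
def pivotProg : Prog :=
  .seq (.nSet 5 (.reg 0)) (forLoop 4 0 (.ite
    (.conj (.neg (.conj (.rLe (.get 0 (.reg 3) (.reg 4)) (.const 0))
        (.rLe (.const 0) (.get 0 (.reg 3) (.reg 4)))))
      (.neg (.nLe (.get 0 (.reg 5) (.const 0)) (.get 0 (.reg 4) (.const 0)))))
    (.nSet 5 (.reg 4)) .skip))

section

variable {m n : ℕ} {T : Fin m → Fin n → ℝ} {w : Fin n → ℕ} {s : Store} {r : Fin m} {b : Fin n}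

theorem pivotProg_runs (hn : s.nReg 0 = n) (hr : s.nReg 3 = r) (hT : HoldsMatrix s T)
    (hw : HoldsWeights s w) (hne : ∃ j, T r j ≠ 0) :
    Runs pivotProg s (n * 50 + 10) fun s' => ∃ b : Fin n, s'.nReg 5 = b ∧ T r b ≠ 0 ∧
      ∀ j, T r j ≠ 0 → w b ≤ w j := by
  refine ((Runs.of_wp (T := 2) (Q := fun s' => s'.nReg 5 = n) (by decide)
    (by simp [Prog.wp, NExp.eval, hn])).seq (T' := n * 50 + 7) fun s1 hf1 h1 => ?_).mono (by omega)
    fun _ _ h => h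
  have hn1 : s1.nReg 0 = n := (hf1.nReg (by decide)).trans hn
  refine Runs.forLoop (T := 30) (fun i s' =>
    (s'.nReg 5 = n ∧ ∀ j : Fin n, (j : ℕ) < i → T r j = 0) ∨
    ∃ b : Fin n, s'.nReg 5 = b ∧ T r b ≠ 0 ∧ ∀ j : Fin n, (j : ℕ) < i → T r j ≠ 0 → w b ≤ w j)
    (by decide) (by decide) (by decide) (by simp [h1]) ?_ ?_ (by rw [hn1]; omega)
  · intro i hi s2 hf2 hi2 hI2
    rw [hn1] at hi
    lift i to Fin n using hi
    have hr2 : s2.nReg 3 = r := (hf2.nReg (by decide)).trans ((hf1.nReg (by decide)).trans hr)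
    have hT2 : HoldsMatrix s2 T := fun q j => by
      rw [hf2.rArr (by decide), hf1.rArr (by decide), hT]
    have hw2 : HoldsWeights s2 w := (hw.congr (hf1.nArr (by decide))).congr (hf2.nArr (by decide))
    have hlt : ∀ j : Fin n, (j : ℕ) < (i : ℕ) + 1 → (j : ℕ) < i ∨ j = i := fun j hj => by
      rw [Fin.ext_iff]; omega
    refine Runs.of_wp (by decide) ?_
    simp only [Prog.wp, Test.holds, NExp.eval, RExp.eval, hr2, hi2, hT2 r i, hw2.eq i,
      Nat.cast_zero, ← le_antisymm_iff, not_le, Store.setN_nReg, Nat.reduceEqDiff, if_true, if_false]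
    constructor
    · rintro ⟨h0, hlt'⟩
      refine Or.inr ⟨i, rfl, h0, fun j hj hj0 => ?_⟩
      obtain hj | rfl := hlt j hj
      · obtain ⟨-, h⟩ | ⟨b, hb, -, h⟩ := hI2
        · exact absurd (h j hj) hj0
        · rw [hb, hw2.eq] at hlt'
          exact hlt'.le.trans (h j hj hj0)
      · exact le_rfl
    · intro hnot
      obtain ⟨hb, h⟩ | ⟨b, hb, hb0, h⟩ := hI2
      · refine Or.inl ⟨hb, fun j hj => ?_⟩
        obtain hj | rfl := hlt j hj
        · exact h j hj
        · by_contra h0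
          refine hnot ⟨h0, ?_⟩
          rw [hb, hw2.last]
          exact hw2.lt j
      · refine Or.inr ⟨b, hb, hb0, fun j hj hj0 => ?_⟩
        obtain hj | rfl := hlt j hj
        · exact h j hj hj0
        · rw [hb, hw2.eq] at hnot
          by_contra hcon
          exact hnot ⟨hj0, not_le.1 hcon⟩
  · intro s2 _ hI2
    rw [hn1] at hI2
    obtain ⟨-, h⟩ | ⟨b, hb, hb0, h⟩ := hI2
    · obtain ⟨j, hj⟩ := hne
      exact absurd (h j j.2) hj
    · exact ⟨b, hb, hb0, fun j => h j j.2⟩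

/-- Divide the pivot row by the pivot. -/
def normalizeProg : Prog :=
  .seq (.rSet 3 (.get 0 (.reg 3) (.reg 5)))
    (forLoop 4 0 (.rPut 0 (.reg 3) (.reg 4) (.div (.get 0 (.reg 3) (.reg 4)) (.reg 3))))

theorem normalizeProg_runs (hn : s.nReg 0 = n) (hr : s.nReg 3 = r) (hb : s.nReg 5 = b)
    (hT : HoldsMatrix s T) :
    Runs normalizeProg s (n * 20 + 15) fun s' =>
      HoldsMatrix s' fun q j => if q = r then T r j / T r b else T q j := by
  refine ((Runs.of_wp (T := 4) (Q := fun s' => s'.rReg 3 = T r b) (by decide)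
    (by simp [Prog.wp, NExp.eval, RExp.eval, hr, hb, hT r b])).seq (T' := n * 20 + 7)
    fun s1 hf1 h1 => ?_).mono (by omega) fun _ _ h => h
  have hn1 : s1.nReg 0 = n := (hf1.nReg (by decide)).trans hn
  have hr1 : s1.nReg 3 = r := (hf1.nReg (by decide)).trans hr
  have hT1 : HoldsMatrix s1 T := fun q j => by rw [hf1.rArr (by decide), hT]
  refine Runs.forLoop (T := 8) (fun i s' => ∀ (q : Fin m) (j : Fin n), s'.rArr 0 q j =
    if q = r ∧ (j : ℕ) < i then T r j / T r b else T q j)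
    (by decide) (by decide) (by decide) (by simpa [HoldsMatrix] using hT1) ?_ ?_ (by rw [hn1]; omega)
  · intro i hi s2 hf2 hi2 hI2
    rw [hn1] at hi
    lift i to Fin n using hi
    have hr2 : s2.nReg 3 = r := (hf2.nReg (by decide)).trans hr1
    have hv2 : s2.rReg 3 = T r b := (hf2.rReg (by decide)).trans h1
    refine Runs.of_wp (by decide) ?_
    simp only [Prog.wp, NExp.eval, RExp.eval, hr2, hi2, hv2, Store.setN_rArr, Store.putR_rArr, hI2]
    intro q j
    by_cases hq : q = r
    · subst hq
      by_cases hj : j = i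
      · subst hj; simp
      · have hj : (j : ℕ) ≠ i := fun h => hj (Fin.ext h)
        simp only [hj, and_false, if_false, true_and]
        congr 1
        rw [eq_iff_iff]
        omega
    · have hq' : (q : ℕ) ≠ r := fun h => hq (Fin.ext h)
      simp [hq, hq']
  · intro s2 _ hI2 q j
    rw [hn1] at hI2
    simp [hI2]

/-- Subtract a multiple of the pivot row from the row given by the index register `6`. -/
def clearRowProg : Prog :=
  .seq (.rSet 4 (.get 0 (.reg 6) (.reg 5)))
    (forLoop 4 0 (.rPut 0 (.reg 6) (.reg 4) (.sub (.get 0 (.reg 6) (.reg 4))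
      (.mul (.reg 4) (.get 0 (.reg 3) (.reg 4))))))

theorem clearRowProg_runs {q₀ : Fin m} (hn : s.nReg 0 = n) (hr : s.nReg 3 = r) (hb : s.nReg 5 = b)
    (hq : s.nReg 6 = q₀) (hqr : q₀ ≠ r) (hT : HoldsMatrix s T) :
    Runs clearRowProg s (n * 25 + 15) fun s' =>
      HoldsMatrix s' fun q j => if q = q₀ then T q j - T q b * T r j else T q j := by
  refine ((Runs.of_wp (T := 4) (Q := fun s' => s'.rReg 4 = T q₀ b) (by decide)
    (by simp [Prog.wp, NExp.eval, RExp.eval, hq, hb, hT q₀ b])).seq (T' := n * 25 + 7)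
    fun s1 hf1 h1 => ?_).mono (by omega) fun _ _ h => h
  have hn1 : s1.nReg 0 = n := (hf1.nReg (by decide)).trans hn
  have hr1 : s1.nReg 3 = r := (hf1.nReg (by decide)).trans hr
  have hq1 : s1.nReg 6 = q₀ := (hf1.nReg (by decide)).trans hq
  have hT1 : HoldsMatrix s1 T := fun q j => by rw [hf1.rArr (by decide), hT]
  refine Runs.forLoop (T := 15) (fun i s' => ∀ (q : Fin m) (j : Fin n), s'.rArr 0 q j =
    if q = q₀ ∧ (j : ℕ) < i then T q j - T q b * T r j else T q j)
    (by decide) (by decide) (by decide) (by simpa [HoldsMatrix] using hT1) ?_ ?_ (by rw [hn1]; omega)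
  · intro i hi s2 hf2 hi2 hI2
    rw [hn1] at hi
    lift i to Fin n using hi
    have hr2 : s2.nReg 3 = r := (hf2.nReg (by decide)).trans hr1
    have hq2 : s2.nReg 6 = q₀ := (hf2.nReg (by decide)).trans hq1
    have hv2 : s2.rReg 4 = T q₀ b := (hf2.rReg (by decide)).trans h1
    refine Runs.of_wp (by decide) ?_
    simp only [Prog.wp, NExp.eval, RExp.eval, hr2, hq2, hi2, hv2, Store.setN_rArr, Store.putR_rArr,
      hI2]
    intro q j
    by_cases hq : q = q₀
    · subst hq
      by_cases hj : j = i
      · subst hj; simp [hqr.symm]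
      · have hj : (j : ℕ) ≠ i := fun h => hj (Fin.ext h)
        simp only [hj, and_false, if_false, true_and]
        congr 1
        rw [eq_iff_iff]
        omega
    · have hq' : (q : ℕ) ≠ q₀ := fun h => hq (Fin.ext h)
      simp [hq, hq']
  · intro s2 _ hI2 q j
    rw [hn1] at hI2
    simp [hI2]

/-- Clear the pivot column in all rows but the pivot row. -/
def eliminateProg : Prog :=
  forLoop 6 1 (.ite (.neg (.conj (.nLe (.reg 6) (.reg 3)) (.nLe (.reg 3) (.reg 6)))) clearRowProg
    .skip)

theorem eliminateProg_runs (hn : s.nReg 0 = n) (hm : s.nReg 1 = m) (hr : s.nReg 3 = r)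
    (hb : s.nReg 5 = b) (hT : HoldsMatrix s fun q j => if q = r then T r j / T r b else T q j) :
    Runs eliminateProg s (m * (n * 25 + 50) + 7) fun s' => HoldsMatrix s' (elimStep T r b) := by
  refine Runs.forLoop (T := n * 25 + 35) (fun i s' => HoldsMatrix s' fun q j =>
    if (q : ℕ) < i ∨ q = r then elimStep T r b q j else T q j)
    (by decide) (by decide) (by decide) ?_ ?_ ?_ (by rw [hm]; nlinarith)
  · intro q j
    simp only [Store.setN_rArr, hT q j, not_lt_zero, false_or, elimStep]
    split_ifs <;> rfl
  · intro i hi s1 hf1 hi1 hI1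
    rw [hm] at hi
    lift i to Fin m using hi
    have hn1 : s1.nReg 0 = n := (hf1.nReg (by decide)).trans hn
    have hr1 : s1.nReg 3 = r := (hf1.nReg (by decide)).trans hr
    have hb1 : s1.nReg 5 = b := (hf1.nReg (by decide)).trans hb
    have hlt : ∀ q : Fin m, q ≠ i → ((q : ℕ) < i ↔ (q : ℕ) < (i : ℕ) + 1) := fun q hq => by
      have : (q : ℕ) ≠ i := fun h => hq (Fin.ext h)
      omega
    have hiff : (Test.neg (.conj (.nLe (.reg 6) (.reg 3)) (.nLe (.reg 3) (.reg 6)))).holds s1 ↔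
        i ≠ r := by
      simp only [Test.holds, NExp.eval, hi1, hr1, ← le_antisymm_iff, Fin.val_inj, ne_eq]
    refine Runs.ite (T := n * 25 + 15) (fun h => ?_) (fun h => ?_)
      (by simp [Test.cost, NExp.cost]; omega)
    · rw [hiff] at h
      refine (clearRowProg_runs hn1 hr1 hb1 hi1 h hI1).mono le_rfl fun s2 _ h2 q j => ?_
      rw [Store.setN_rArr, h2]
      by_cases hq : q = i
      · subst hq
        simp [h, elimStep]
      · simp only [hq, if_false, hlt q hq]
    · rw [hiff, not_not] at h
      refine Runs.of_wp (by simp [Prog.bound]) ?_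
      intro q j
      rw [Store.setN_rArr, hI1]
      by_cases hq : q = i
      · subst hq
        simp [h]
      · simp only [hlt q hq]
  · intro s1 _ hI1 q j
    rw [hm] at hI1
    simp [hI1 q j]

/-- Transform the matrix in the real array `0` into a tableau; the pivot columns are put into the
index array `5`. -/
def elimProg : Prog :=
  .seq (.nPut 0 (.reg 0) (.const 0) (.reg 0)) (forLoop 3 1 (.seq pivotProg
    (.seq (.nPut 5 (.reg 3) (.const 0) (.reg 5)) (.seq normalizeProg eliminateProg))))

/-- The real array `0` and the index array `5` hold the tableau `T` with pivot columns `c`. -/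
def HoldsTableau {m n : ℕ} (s : Store) (T : Fin m → Fin n → ℝ) (c : Fin m → Fin n) : Prop :=
  HoldsMatrix s T ∧ ∀ r : Fin m, s.nArr 5 r 0 = c r

theorem elimProg_runs {A : Matrix (Fin m) (Fin n) ℝ} (hA : A.rank = m) (hpos : 0 < n)
    (hn : s.nReg 0 = n) (hm : s.nReg 1 = m) (hT : HoldsMatrix s A)
    (hw : ∀ i : Fin n, s.nArr 0 i 0 = w i) (hwn : ∀ i, w i < n) :
    Runs elimProg s (m * (m * (n * 25 + 50) + n * 70 + 70) + 15) fun s' =>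
      (∀ i : Fin n, s'.nArr 0 i 0 = w i) ∧
      ∃ (T : Fin m → Fin n → ℝ) (c : Fin m → Fin n), ElimState (kerSpace A) w m T c ∧ HoldsTableau s' T c := by
  refine ((Runs.of_wp (T := 5) (Q := fun s' => HoldsWeights s' w) (by decide) ?_).seq
    (T' := m * (m * (n * 25 + 50) + n * 70 + 70) + 7) fun s1 hf1 hw1 => ?_).mono (by omega)
    fun _ _ h => h
  · refine ⟨fun i => ?_, hwn, ?_⟩
    · have := i.2.ne
      simp [NExp.eval, hn, this, hw]
    · simp [NExp.eval, hn]
  have hm1 : s1.nReg 1 = m := (hf1.nReg (by decide)).trans hm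
  refine Runs.forLoop (T := m * (n * 25 + 50) + n * 70 + 50) (fun k s' =>
    ∃ (T : Fin m → Fin n → ℝ) (c : Fin m → Fin n), ElimState (kerSpace A) w k T c ∧ HoldsMatrix s' T ∧
    ∀ r : Fin m, (r : ℕ) < k → s'.nArr 5 r 0 = c r)
    (by decide) (by decide) (by decide) ?_ ?_ ?_ (by rw [hm1]; nlinarith)
  · refine ⟨A, fun _ => ⟨0, hpos⟩, ⟨mem_kerSpace_iff A, by simp, by simp⟩, fun q j => ?_, by simp⟩
    rw [Store.setN_rArr, hf1.rArr (by decide), hT]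
  · rintro r hr s2 hf2 hr2 ⟨T, c, hel, hT2, hc2⟩
    rw [hm1] at hr
    lift r to Fin m using hr
    have hm2 : s2.nReg 1 = m := (hf2.nReg (by decide)).trans hm1
    have hn2 : s2.nReg 0 = n := (hf2.nReg (by decide)).trans ((hf1.nReg (by decide)).trans hn)
    have hw2 : HoldsWeights s2 w := hw1.congr (hf2.nArr (by decide))
    refine ((pivotProg_runs hn2 hr2 hT2 hw2 (exists_ne_zero_of_rank hA hel.mem_iff r)).seq
      (T' := m * (n * 25 + 50) + n * 20 + 40) fun s3 hf3 ⟨b, hb3, hb0, hmin⟩ => ?_).mono (by omega)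
      fun _ _ h => h
    have hr3 : s3.nReg 3 = r := (hf3.nReg (by decide)).trans hr2
    refine ((Runs.of_wp (T := 5) (Q := fun s' => ∀ q : Fin m, (q : ℕ) < (r : ℕ) + 1 →
        s'.nArr 5 q 0 = Function.update c r b q) (by decide) ?_).seq
      (T' := m * (n * 25 + 50) + n * 20 + 30) fun s4 hf4 h4 => ?_).mono (by omega) fun _ _ h => h
    · simp only [Prog.wp, NExp.eval, Store.putN_nArr, hr3, hb3]
      intro q hq
      by_cases hqr : q = r
      · subst hqr
        simp
      · have hqr' : (q : ℕ) ≠ r := fun h => hqr (Fin.ext h)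
        have h := hc2 q (by omega)
        rw [← hf3.nArr (by decide)] at h
        simp [hqr, hqr', h]
    have hr4 : s4.nReg 3 = r := (hf4.nReg (by decide)).trans hr3
    have hb4 : s4.nReg 5 = b := (hf4.nReg (by decide)).trans hb3
    have hn4 : s4.nReg 0 = n := (hf4.nReg (by decide)).trans ((hf3.nReg (by decide)).trans hn2)
    have hm4 : s4.nReg 1 = m := (hf4.nReg (by decide)).trans ((hf3.nReg (by decide)).trans hm2)
    have hT4 : HoldsMatrix s4 T := fun q j => by
      rw [hf4.rArr (by decide), hf3.rArr (by decide), hT2]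
    refine ((normalizeProg_runs hn4 hr4 hb4 hT4).seq (T' := m * (n * 25 + 50) + 7)
      fun s5 hf5 h5 => ?_).mono (by omega) fun _ _ h => h
    refine (eliminateProg_runs ((hf5.nReg (by decide)).trans hn4) ((hf5.nReg (by decide)).trans hm4)
      ((hf5.nReg (by decide)).trans hr4) ((hf5.nReg (by decide)).trans hb4) h5).mono le_rfl
      fun s6 hf6 h6 => ?_
    refine ⟨_, _, hel.step hb0 hmin, h6, fun q hq => ?_⟩
    rw [Store.setN_nArr, hf6.nArr (by decide), hf5.nArr (by decide), h4 q hq]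
  · rintro s2 hf2 ⟨T, c, hel, hT2, hc2⟩
    rw [hm1] at hel hc2
    exact ⟨fun i => by rw [hf2.nArr (by decide), hw1.eq], T, c, hel, hT2, fun r => hc2 r r.2⟩

end

/-! ### Verifying the lifting scores -/

/-- For the row with pivot in the index register `5`, put a column of maximal layer among the pivot
column and the columns with a large rescaled entry into the index register `6`, and the absolute
value of that entry into the real register `4`. -/
def largeEntryProg : Prog :=
  .seq (.nSet 6 (.reg 5)) (forLoop 4 0
    (.seq (.rSet 3 (.div (.mul (.get 1 (.reg 5) (.const 0)) (.get 0 (.reg 3) (.reg 4)))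
        (.get 1 (.reg 4) (.const 0))))
      (.seq (.ite (.rLe (.const 0) (.reg 3)) .skip (.rSet 3 (.sub (.const 0) (.reg 3))))
        (.ite (.conj (.rLe (.reg 2) (.reg 3))
            (.neg (.nLe (.get 0 (.reg 4) (.const 0)) (.get 0 (.reg 6) (.const 0)))))
          (.seq (.nSet 6 (.reg 4)) (.rSet 4 (.reg 3))) .skip))))

section

variable {m n p : ℕ} {T : Fin m → Fin n → ℝ} {c : Fin m → Fin n} {δ : Fin n → ℝ} {w : Fin n → ℕ}
  {s : Store} {σ : ℝ}

/-- The entries of the tableau of the rescaled subspace. -/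
def scaledEntry (T : Fin m → Fin n → ℝ) (c : Fin m → Fin n) (δ : Fin n → ℝ) (r : Fin m)
    (i : Fin n) : ℝ := δ (c r) * T r i / δ i

theorem largeEntryProg_runs {r : Fin m} (hn : s.nReg 0 = n) (hr : s.nReg 3 = r)
    (hc : s.nReg 5 = c r) (hσ : s.rReg 2 = σ) (hδ : ∀ i : Fin n, s.rArr 1 i 0 = δ i)
    (hT : HoldsMatrix s T) (hw : ∀ i : Fin n, s.nArr 0 i 0 = w i) :
    Runs largeEntryProg s (n * 70 + 10) fun s' => ∃ b : Fin n, s'.nReg 6 = b ∧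
      (w (c r) < w b → σ ≤ |scaledEntry T c δ r b| ∧ s'.rReg 4 = |scaledEntry T c δ r b|) ∧
      ∀ i, σ ≤ |scaledEntry T c δ r i| → w i ≤ w b := by
  refine ((Runs.of_wp (T := 2) (Q := fun s' => s'.nReg 6 = c r) (by decide)
    (by simp [Prog.wp, NExp.eval, hc])).seq (T' := n * 70 + 7) fun s1 hf1 h1 => ?_).mono
    (by omega) fun _ _ h => h
  have hn1 : s1.nReg 0 = n := (hf1.nReg (by decide)).trans hn
  refine Runs.forLoop (T := 55) (fun i s' => ∃ b : Fin n, s'.nReg 6 = b ∧ w (c r) ≤ w b ∧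
    (w (c r) < w b → σ ≤ |scaledEntry T c δ r b| ∧ s'.rReg 4 = |scaledEntry T c δ r b|) ∧
    ∀ j : Fin n, (j : ℕ) < i → σ ≤ |scaledEntry T c δ r j| → w j ≤ w b)
    (by decide) (by decide) (by decide) ⟨c r, by simp [h1], le_rfl, by simp⟩ ?_ ?_ (by rw [hn1]; omega)
  · rintro i hi s2 hf2 hi2 ⟨b, hb, hcb, hb1, hb2⟩
    rw [hn1] at hi
    lift i to Fin n using hi
    have hr2 : s2.nReg 3 = r := (hf2.nReg (by decide)).trans ((hf1.nReg (by decide)).trans hr)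
    have hc2 : s2.nReg 5 = c r := (hf2.nReg (by decide)).trans ((hf1.nReg (by decide)).trans hc)
    have hσ2 : s2.rReg 2 = σ := (hf2.rReg (by decide)).trans ((hf1.rReg (by decide)).trans hσ)
    have hδ2 : ∀ i : Fin n, s2.rArr 1 i 0 = δ i := fun i => by
      rw [hf2.rArr (by decide), hf1.rArr (by decide), hδ]
    have hT2 : HoldsMatrix s2 T := fun q j => by
      rw [hf2.rArr (by decide), hf1.rArr (by decide), hT]
    have hw2 : ∀ i : Fin n, s2.nArr 0 i 0 = w i := fun i => by
      rw [hf2.nArr (by decide), hf1.nArr (by decide), hw]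
    have habs : Runs (.seq (.rSet 3 (.div (.mul (.get 1 (.reg 5) (.const 0))
        (.get 0 (.reg 3) (.reg 4))) (.get 1 (.reg 4) (.const 0))))
        (.ite (.rLe (.const 0) (.reg 3)) .skip (.rSet 3 (.sub (.const 0) (.reg 3))))) s2 30
        fun s' => s'.rReg 3 = |scaledEntry T c δ r i| := by
      refine Runs.of_wp (by decide) ?_
      simp only [Prog.wp, Test.holds, NExp.eval, RExp.eval, hr2, hc2, hi2, hδ2, hT2 r i,
        Store.setR_rReg, Nat.cast_zero, if_true]
      refine ⟨fun h => (abs_of_nonneg h).symm, fun h => ?_⟩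
      rw [zero_sub]
      exact (abs_of_neg (not_le.1 h)).symm
    obtain ⟨s3, t3, he3, ht3, h3⟩ := habs
    have hf3 := he3.frame
    have hrest : Runs (.ite (.conj (.rLe (.reg 2) (.reg 3))
            (.neg (.nLe (.get 0 (.reg 4) (.const 0)) (.get 0 (.reg 6) (.const 0)))))
          (.seq (.nSet 6 (.reg 4)) (.rSet 4 (.reg 3))) .skip) s3 20 fun s' =>
          ∃ b : Fin n, s'.nReg 6 = b ∧ w (c r) ≤ w b ∧
          (w (c r) < w b → σ ≤ |scaledEntry T c δ r b| ∧ s'.rReg 4 = |scaledEntry T c δ r b|) ∧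
          ∀ j : Fin n, (j : ℕ) < (i : ℕ) + 1 → σ ≤ |scaledEntry T c δ r j| →
            w j ≤ w b := by
      have hb3 : s3.nReg 6 = b := (hf3.nReg (by decide)).trans hb
      have hi3 : s3.nReg 4 = i := (hf3.nReg (by decide)).trans hi2
      have hσ3 : s3.rReg 2 = σ := (hf3.rReg (by decide)).trans hσ2
      have h43 : s3.rReg 4 = s2.rReg 4 := hf3.rReg (by decide)
      have hw3 : ∀ i : Fin n, s3.nArr 0 i 0 = w i := fun i => by rw [hf3.nArr (by decide), hw2]
      have hlt : ∀ j : Fin n, (j : ℕ) < (i : ℕ) + 1 → (j : ℕ) < i ∨ j = i := fun j hj => by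
        rw [Fin.ext_iff]; omega
      refine Runs.of_wp (by decide) ?_
      simp only [Prog.wp, Test.holds, NExp.eval, RExp.eval, hb3, hi3, hσ3, h3, hw3, not_le,
        Store.setR_nReg, Store.setN_nReg, Store.setR_rReg, Store.setN_rReg, if_true]
      constructor
      · rintro ⟨h, hbi⟩
        refine ⟨i, rfl, hcb.trans hbi.le, fun _ => ⟨h, rfl⟩, fun j hj hjσ => ?_⟩
        obtain hj | rfl := hlt j hj
        · exact (hb2 j hj hjσ).trans hbi.le
        · exact le_rfl
      · intro h
        refine ⟨b, rfl, hcb, by rwa [h43], fun j hj hjσ => ?_⟩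
        obtain hj | rfl := hlt j hj
        · exact hb2 j hj hjσ
        · exact not_lt.1 fun h' => h ⟨hjσ, h'⟩
    obtain ⟨s4, t4, he4, ht4, h4⟩ := hrest
    cases he3 with
    | seq _ _ _ s' _ t t' he he' =>
      refine ⟨s4, _, .seq _ _ _ _ _ _ _ he (.seq _ _ _ _ _ _ _ he' he4), by omega, ?_⟩
      simpa using h4
  · rintro s2 hf2 ⟨b, hb, hcb, hb1, hb2⟩
    rw [hn1] at hb2
    exact ⟨b, hb, hb1, fun j => hb2 j j.2⟩

/-- Record the entry found by `largeEntryProg` for all layers between those of its row and of its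
column. -/
def recordProg : Prog :=
  forLoop 4 2 (.ite (.conj (.neg (.nLe (.reg 4) (.get 0 (.reg 5) (.const 0))))
      (.nLe (.reg 4) (.get 0 (.reg 6) (.const 0))))
    (.seq (.nPut 6 (.reg 4) (.const 0) (.const 1)) (.seq (.nPut 7 (.reg 4) (.const 0) (.reg 6))
      (.seq (.nPut 8 (.reg 4) (.const 0) (.reg 5)) (.rPut 3 (.reg 4) (.const 0) (.reg 4)))))
    .skip)

/-- The recorded entry for layer `k`: it is large, and its row has its pivot below layer `k`, while
its column is in layer `k` or above. -/
def HoldsEntry (s : Store) (T : Fin m → Fin n → ℝ) (c : Fin m → Fin n) (δ : Fin n → ℝ)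
    (w : Fin n → ℕ) (σ : ℝ) (k : ℕ) : Prop :=
  s.nArr 6 k 0 = 1 → ∃ (r : Fin m) (i : Fin n), w (c r) < k ∧ k ≤ w i ∧
    σ ≤ |scaledEntry T c δ r i| ∧ s.nArr 7 k 0 = i ∧ s.nArr 8 k 0 = c r ∧
    s.rArr 3 k 0 = |scaledEntry T c δ r i|

theorem recordProg_runs {r : Fin m} {b : Fin n} (hp : s.nReg 2 = p) (hc : s.nReg 5 = c r)
    (hb : s.nReg 6 = b) (hw : ∀ i : Fin n, s.nArr 0 i 0 = w i)
    (hval : w (c r) < w b → σ ≤ |scaledEntry T c δ r b| ∧ s.rReg 4 = |scaledEntry T c δ r b|)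
    (hs : ∀ k, HoldsEntry s T c δ w σ k) :
    Runs recordProg s (p * 50 + 7) fun s' => (∀ k, HoldsEntry s' T c δ w σ k) ∧
      (∀ k, s'.nArr 6 k 0 ≠ 1 → s.nArr 6 k 0 ≠ 1) ∧
      ∀ k < p, s'.nArr 6 k 0 ≠ 1 → w (c r) < k → w b < k := by
  refine Runs.forLoop (T := 40) (fun l s' => (∀ k, HoldsEntry s' T c δ w σ k) ∧
    (∀ k, s'.nArr 6 k 0 ≠ 1 → s.nArr 6 k 0 ≠ 1) ∧
    ∀ k < l, s'.nArr 6 k 0 ≠ 1 → w (c r) < k → w b < k)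
    (by decide) (by decide) (by decide) ⟨hs, by simp, by simp⟩ ?_ ?_ (by rw [hp]; omega)
  · rintro l hl s1 hf1 hl1 ⟨hI1, hI2, hI3⟩
    have hc1 : s1.nReg 5 = c r := (hf1.nReg (by decide)).trans hc
    have hb1 : s1.nReg 6 = b := (hf1.nReg (by decide)).trans hb
    have hv1 : s1.rReg 4 = s.rReg 4 := hf1.rReg (by decide)
    have hw1 : ∀ i : Fin n, s1.nArr 0 i 0 = w i := fun i => by rw [hf1.nArr (by decide), hw]
    refine Runs.of_wp (by decide) ?_
    simp only [Prog.wp, Test.holds, NExp.eval, RExp.eval, hc1, hb1, hl1, hw1, not_le,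
      Store.putN_nReg, Store.putN_rReg]
    constructor
    · rintro ⟨h1, h2⟩
      obtain ⟨h3, h4⟩ := hval (h1.trans_le h2)
      refine ⟨fun k => ?_, fun k => ?_, fun k hk => ?_⟩
      · by_cases hkl : k = l
        · subst hkl
          intro _
          exact ⟨r, b, h1, h2, h3, by simp, by simp, by simp [hv1, h4]⟩
        · have := hI1 k
          simpa [HoldsEntry, hkl] using this
      · by_cases hkl : k = l
        · simp [hkl]
        · simpa [hkl] using hI2 k
      · by_cases hkl : k = l
        · simp [hkl]
        · simpa [hkl] using hI3 k (by omega)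
    · intro h
      refine ⟨hI1, hI2, fun k hk hk1 hck => ?_⟩
      by_cases hkl : k = l
      · subst hkl
        exact not_le.1 fun h' => h ⟨hck, h'⟩
      · exact hI3 k (by omega) hk1 hck
  · intro s1 _ hI1
    rwa [hp] at hI1

/-- Find large entries for all layers. -/
def verifyProg : Prog :=
  forLoop 3 1 (.seq (.nSet 5 (.get 5 (.reg 3) (.const 0))) (.seq largeEntryProg recordProg))

theorem verifyProg_runs (hn : s.nReg 0 = n) (hm : s.nReg 1 = m) (hp : s.nReg 2 = p) (hpn : p ≤ n)
    (hσ : s.rReg 2 = σ) (hδ : ∀ i : Fin n, s.rArr 1 i 0 = δ i) (hT : HoldsTableau s T c)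
    (hw : ∀ i : Fin n, s.nArr 0 i 0 = w i) (h0 : ∀ k, s.nArr 6 k 0 = 0) :
    Runs verifyProg s (m * (n * 120 + 40) + 7) fun s' => (∀ k, HoldsEntry s' T c δ w σ k) ∧
      ∀ k < p, s'.nArr 6 k 0 ≠ 1 → ∀ (r : Fin m) (i : Fin n), w (c r) < k → k ≤ w i →
        |scaledEntry T c δ r i| < σ := by
  refine Runs.forLoop (T := n * 120 + 30) (fun l s' => (∀ k, HoldsEntry s' T c δ w σ k) ∧
      ∀ k < p, s'.nArr 6 k 0 ≠ 1 → ∀ (r : Fin m) (i : Fin n), (r : ℕ) < l → w (c r) < k →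
        k ≤ w i → |scaledEntry T c δ r i| < σ)
    (by decide) (by decide) (by decide) ⟨fun k h => ?_, by simp⟩ ?_ ?_ (by rw [hm]; nlinarith)
  · simp [h0] at h
  · rintro r hr s1 hf1 hr1 ⟨hI1, hI2⟩
    rw [hm] at hr
    lift r to Fin m using hr
    have hA5 : s1.nArr 5 r 0 = c r := by rw [hf1.nArr (by decide), hT.2]
    refine ((Runs.of_wp (T := 5) (Q := fun s' => s'.nReg 5 = c r) (by decide)
      (by simp [Prog.wp, NExp.eval, hr1, hA5])).seq (T' := n * 120 + 20) fun s2 hf2 h2 => ?_).mono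
      (by omega) fun _ _ h => h
    have hn2 : s2.nReg 0 = n := (hf2.nReg (by decide)).trans ((hf1.nReg (by decide)).trans hn)
    have hp2 : s2.nReg 2 = p := (hf2.nReg (by decide)).trans ((hf1.nReg (by decide)).trans hp)
    have hr2 : s2.nReg 3 = r := (hf2.nReg (by decide)).trans hr1
    have hσ2 : s2.rReg 2 = σ := (hf2.rReg (by decide)).trans ((hf1.rReg (by decide)).trans hσ)
    have hδ2 : ∀ i : Fin n, s2.rArr 1 i 0 = δ i := fun i => by
      rw [hf2.rArr (by decide), hf1.rArr (by decide), hδ]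
    have hT2 : HoldsMatrix s2 T := fun q j => by
      rw [hf2.rArr (by decide), hf1.rArr (by decide), hT.1]
    have hw2 : ∀ i : Fin n, s2.nArr 0 i 0 = w i := fun i => by
      rw [hf2.nArr (by decide), hf1.nArr (by decide), hw]
    refine ((largeEntryProg_runs hn2 hr2 h2 hσ2 hδ2 hT2 hw2).seq (T' := p * 50 + 7)
      fun s3 hf3 ⟨b, hb, hval, hmax⟩ => ?_).mono (by omega) fun _ _ h => h
    have hA3 : s3.nArr = s1.nArr := funext fun a =>
      (hf3.nArr (by simp [largeEntryProg, forLoop, Prog.nArrs])).trans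
        (hf2.nArr (by simp [Prog.nArrs]))
    have hR3 : s3.rArr = s1.rArr := funext fun a =>
      (hf3.rArr (by simp [largeEntryProg, forLoop, Prog.rArrs])).trans
        (hf2.rArr (by simp [Prog.rArrs]))
    refine (recordProg_runs ((hf3.nReg (by decide)).trans hp2) ((hf3.nReg (by decide)).trans h2) hb
      (fun i => by rw [hf3.nArr (by decide), hw2]) hval (fun k => ?_)).mono le_rfl
      fun s4 hf4 ⟨h4, h5, h6⟩ => ⟨h4, fun k hk hk1 r' i hr' hck hki => ?_⟩
    · have := hI1 k
      rwa [HoldsEntry, ← hA3, ← hR3] at this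
    · by_cases hrr : r' = r
      · subst hrr
        refine not_le.1 fun h => ?_
        have h7 := hmax i h
        have h8 := h6 k hk hk1 hck
        omega
      · have hrr : (r' : ℕ) ≠ r := fun h => hrr (Fin.ext h)
        refine hI2 k hk ?_ r' i (by omega) hck hki
        rw [← hA3]
        exact h5 k hk1
  · rintro s1 _ ⟨hI1, hI2⟩
    exact ⟨hI1, fun k hk hk1 r i => hI2 k hk hk1 r i (by rw [hm]; exact r.2)⟩

/-- Update the estimates and the digraph according to the recorded entries. -/
def updateProg : Prog :=
  forLoop 3 2 (.ite (.conj (.nLe (.const 1) (.get 6 (.reg 3) (.const 0)))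
      (.nLe (.get 6 (.reg 3) (.const 0)) (.const 1)))
    (.seq (.nPut 1 (.get 7 (.reg 3) (.const 0)) (.get 8 (.reg 3) (.const 0)) (.const 1))
      (.rPut 2 (.get 7 (.reg 3) (.const 0)) (.get 8 (.reg 3) (.const 0))
        (.div (.mul (.get 3 (.reg 3) (.const 0)) (.get 1 (.get 7 (.reg 3) (.const 0)) (.const 0)))
          (.get 1 (.get 8 (.reg 3) (.const 0)) (.const 0)))))
    .skip)

theorem scaled_isTableau {W : Submodule ℝ (Vec n)} (hel : ElimState W w m T c)
    (hδ : ∀ i, 0 < δ i) : IsTableau (rescale δ W) (scaledEntry T c δ) c :=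
  hel.isTableau.rescale hδ

theorem verifyLift_pass {W : Submodule ℝ (Vec n)} {C : Layering n} {β : ℝ} (hpos : 0 < n)
    (hβ : 0 < β) (hel : ElimState W (fun i => (C.layer i : ℕ)) m T c) (hδ : ∀ i, 0 < δ i) {k : ℕ}
    (h : ∀ (r : Fin m) (i : Fin n), (C.layer (c r) : ℕ) < k → k ≤ (C.layer i : ℕ) →
        |scaledEntry T c δ r i| < gam n β / n) :
    VerifyLift (rescale δ W) (C.upper k) (gam n β) .pass := by
  refine (scaled_isTableau hel hδ).liftScore_le _ ?_ (gam_pos hpos hβ).le ?_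
  · intro r hr j hj
    rw [Layering.mem_upper] at hr hj
    by_contra h0
    have h1 := hel.minimal r r.2 j fun h' => h0 (by simp [scaledEntry, h'])
    omega
  · intro r hr i hi
    rw [Layering.mem_upper] at hr hi
    exact (h r i (by omega) hi).le

theorem verifyLift_fail {W : Submodule ℝ (Vec n)} {C : Layering n} {β : ℝ} (hpos : 0 < n)
    (hβ : 0 < β) (hel : ElimState W (fun i => (C.layer i : ℕ)) m T c) (hδ : ∀ i, 0 < δ i) {k : ℕ}
    {r : Fin m} {i : Fin n} (hr : (C.layer (c r) : ℕ) < k) (hi : k ≤ (C.layer i : ℕ))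
    (h : gam n β / n ≤ |scaledEntry T c δ r i|) :
    VerifyLift (rescale δ W) (C.upper k) (gam n β)
      (.fail i (c r) |scaledEntry T c δ r i|) := by
  refine ⟨by simpa using hi, by simpa using hr, h, (scaled_isTableau hel hδ).le_kappa ?_ ?_⟩
  · rintro rfl
    omega
  · exact abs_pos.1 ((gam_div_pos hpos hβ).trans_le h)

theorem updateProg_runs {W : Submodule ℝ (Vec n)} {C : Layering n} {β : ℝ}
    {κh : Fin n → Fin n → ℝ} (hpos : 0 < n)
    (hβ : 0 < β) (hel : ElimState W (fun i => (C.layer i : ℕ)) m T c) (hδ : ∀ i, 0 < δ i)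
    (hp : s.nReg 2 = C.p) (hδs : ∀ i : Fin n, s.rArr 1 i 0 = δ i)
    (hκ : ∀ i j : Fin n, s.rArr 2 i j = κh i j)
    (hG : HoldsGraph s (estGraph κh δ (gam n β / n)))
    (h1 : ∀ k, HoldsEntry s T c δ (fun i => (C.layer i : ℕ)) (gam n β / n) k)
    (h2 : ∀ k < C.p, s.nArr 6 k 0 ≠ 1 → ∀ (r : Fin m) (i : Fin n), (C.layer (c r) : ℕ) < k →
      k ≤ (C.layer i : ℕ) → |scaledEntry T c δ r i| < gam n β / n) :
    Runs updateProg s (C.p * 60 + 7) fun s' => ∃ κ' E, LoopState W β δ κh C C.p κ' E ∧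
      HoldsGraph s' E ∧ ∀ i j : Fin n, s'.rArr 2 i j = κ' i j := by
  have hCp : 0 < C.p := (C.layer ⟨0, hpos⟩).pos
  refine Runs.forLoop (T := 50) (fun k s' => ∃ κ' E, LoopState W β δ κh C (max 1 k) κ' E ∧
      HoldsGraph s' E ∧ ∀ i j : Fin n, s'.rArr 2 i j = κ' i j)
    (by decide) (by decide) (by decide) ⟨κh, _, .start, hG, hκ⟩ ?_ ?_ (by rw [hp]; omega)
  · rintro k hk s1 hf1 hk1 ⟨κ', E, hloop, hG1, hκ1⟩
    rw [hp] at hk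
    have hδ1 : ∀ i : Fin n, s1.rArr 1 i 0 = δ i := fun i => by rw [hf1.rArr (by decide), hδs]
    have h6 : s1.nArr 6 = s.nArr 6 := hf1.nArr (by decide)
    have h7 : s1.nArr 7 = s.nArr 7 := hf1.nArr (by decide)
    have h8 : s1.nArr 8 = s.nArr 8 := hf1.nArr (by decide)
    have hr3 : s1.rArr 3 = s.rArr 3 := hf1.rArr (by decide)
    refine Runs.of_wp (by decide) ?_
    simp only [Prog.wp, Test.holds, NExp.eval, RExp.eval, hk1, h6, ← le_antisymm_iff]
    constructor
    · intro h
      obtain ⟨r, i, hck, hki, hσ, hi, hc, ht⟩ := h1 k h.symm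
      rw [show max 1 k = k by omega] at hloop
      refine ⟨_, _, by
        rw [show max 1 (k + 1) = k + 1 by omega]
        exact .fail k κ' E i (c r) _ hloop hk (verifyLift_fail hpos hβ hel hδ hck hki hσ), ?_, ?_⟩
      · intro a b
        simp only [Store.setN_nArr, Store.putR_nArr, Store.putN_nArr, h7, h8, hi, hc, true_and,
          hG1 a b, Fin.val_inj]
        by_cases hab : a = i ∧ b = c r
        · simp [hab]
        · by_cases hEab : E a b <;> simp [hEab, hab]
      · intro a b
        simp only [Store.setN_rArr, Store.putR_rArr, Store.putN_rArr, Store.putN_nReg, hk1,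
          Store.putN_nArr, h7, h8, hr3, hi, hc, ht, hδ1, true_and, hκ1, Fin.val_inj,
          Nat.reduceEqDiff, false_and, if_false]
    · intro h
      rcases Nat.eq_zero_or_pos k with hk0 | hk0
      · subst hk0
        exact ⟨κ', E, hloop, hG1, hκ1⟩
      · rw [show max 1 k = k by omega] at hloop
        refine ⟨κ', E, ?_, hG1, hκ1⟩
        rw [show max 1 (k + 1) = k + 1 by omega]
        exact .pass k κ' E hloop hk (verifyLift_pass hpos hβ hel hδ (h2 k hk (Ne.symm h)))
  · intro s1 _ hI1
    rwa [hp, show max 1 C.p = C.p by omega] at hI1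

/-! ### The complete program -/

/-- The subroutine Layering. -/
def layeringProg : Prog :=
  .seq thresholdProg (.seq graphProg (.seq sccProg (.seq elimProg (.seq verifyProg
    (.seq updateProg sccProg)))))

theorem layeringProg_runs {A : Matrix (Fin m) (Fin n) ℝ} {β : ℝ} {κh : Fin n → Fin n → ℝ}
    (hpos : 0 < n) (hA : A.rank = m) (hβ : 0 < β) (hβ' : β ≤ 1 / 4) (hδ : ∀ i, 0 < δ i)
    (hκ : IsEstimate (kerSpace A) κh) :
    Runs layeringProg (inputStore A β δ κh) (3000 * (n * m ^ 2 + n ^ 2)) fun s =>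
      ∃ J κ', Holds s J κ' ∧ LayeringReturns (kerSpace A) β δ κh J κ' := by
  set s0 := inputStore A β δ κh with hs0
  have hF := estGraph_isSemicomplete hpos hβ hβ' hδ hκ
  have hn0 : s0.nReg 0 = n := by simp [hs0, inputStore]
  have hm0 : s0.nReg 1 = m := by simp [hs0, inputStore]
  have hβ0 : s0.rReg 0 = β := by simp [hs0, inputStore]
  have hA0 : HoldsMatrix s0 A := fun q j => by simp [hs0, inputStore]
  have hδ0 : ∀ i : Fin n, s0.rArr 1 i 0 = δ i := fun i => by simp [hs0, inputStore]
  have hκ0 : ∀ i j : Fin n, s0.rArr 2 i j = κh i j := fun i j => by simp [hs0, inputStore]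
  have hz0 : ∀ k, s0.nArr 6 k 0 = 0 := fun k => rfl
  refine Runs.mono (T := (n * 20 + 50) + ((n * (n * 40 + 16) + 7) + ((n * (n * 200 + 200) + 50) +
    ((m * (m * (n * 25 + 50) + n * 70 + 70) + 15) + ((m * (n * 120 + 40) + 7) +
    ((n * 60 + 7) + (n * (n * 200 + 200) + 50))))))) ?_ ?_ fun _ _ h => h
  · refine (thresholdProg_runs hn0 hβ0).seq fun s1 hf1 h1 => ?_
    have hn1 : s1.nReg 0 = n := (hf1.nReg (by decide)).trans hn0
    have hm1 : s1.nReg 1 = m := (hf1.nReg (by decide)).trans hm0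
    have hR1 : s1.rArr = s0.rArr := funext fun a =>
      hf1.rArr (by simp [thresholdProg, forLoop, Prog.rArrs])
    refine (graphProg_runs hn1 (by rwa [hR1]) (by rwa [hR1])).seq fun s2 hf2 h2 => ?_
    rw [h1] at h2
    have hn2 : s2.nReg 0 = n := (hf2.nReg (by decide)).trans hn1
    have hm2 : s2.nReg 1 = m := (hf2.nReg (by decide)).trans hm1
    have hR2 : s2.rArr = s0.rArr := (funext fun a =>
      hf2.rArr (by simp [graphProg, forLoop, Prog.rArrs])).trans hR1
    have hσ2 : s2.rReg 2 = gam n β / n := (hf2.rReg (by decide)).trans h1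
    refine (sccProg_runs hF hpos hn2 h2).seq fun s3 hf3 h3 => ?_
    set C := sccLayering hF hpos with hC
    have hCp : C.p ≤ n := by
      simpa using Fintype.card_le_of_surjective _ C.surj
    have hn3 : s3.nReg 0 = n := (hf3.nReg (by decide)).trans hn2
    have hm3 : s3.nReg 1 = m := (hf3.nReg (by decide)).trans hm2
    have hR3 : s3.rArr = s0.rArr := (funext fun a =>
      hf3.rArr (by simp [sccProg, degreeProg, clearProg, cutSumProg, bumpProg, forLoop,
        Prog.rArrs])).trans hR2
    have hσ3 : s3.rReg 2 = gam n β / n := (hf3.rReg (by decide)).trans hσ2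
    refine (elimProg_runs hA hpos hn3 hm3 (fun q j => by rw [hR3, hA0]) h3.2
      fun i => (C.layer i).2.trans_le hCp).seq fun s4 hf4 ⟨hw4, T, c, hel, hT4⟩ => ?_
    have hn4 : s4.nReg 0 = n := (hf4.nReg (by decide)).trans hn3
    have hm4 : s4.nReg 1 = m := (hf4.nReg (by decide)).trans hm3
    have hp4 : s4.nReg 2 = C.p := (hf4.nReg (by decide)).trans h3.1
    have hσ4 : s4.rReg 2 = gam n β / n := (hf4.rReg (by decide)).trans hσ3
    have hδ4 : ∀ i : Fin n, s4.rArr 1 i 0 = δ i := fun i => by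
      rw [hf4.rArr (by decide), hR3, hδ0]
    have hz4 : ∀ k, s4.nArr 6 k 0 = 0 := fun k => by
      rw [hf4.nArr (by decide), hf3.nArr (by decide), hf2.nArr (by decide), hf1.nArr (by decide),
        hz0]
    refine (verifyProg_runs hn4 hm4 hp4 hCp hσ4 hδ4 hT4 hw4 hz4).seq fun s5 hf5 ⟨h5, h5'⟩ => ?_
    have hn5 : s5.nReg 0 = n := (hf5.nReg (by decide)).trans hn4
    have hG5 : HoldsGraph s5 (estGraph κh δ (gam n β / n)) := fun i j => by
      rw [hf5.nArr (by decide), hf4.nArr (by decide), hf3.nArr (by decide), h2 i j]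
    refine Runs.seq ((updateProg_runs (κh := κh) hpos hβ hel hδ
      ((hf5.nReg (by decide)).trans hp4)
      (fun i => by rw [hf5.rArr (by decide), hδ4])
      (fun i j => by rw [hf5.rArr (by decide), hf4.rArr (by decide), hR3, hκ0]) hG5 h5 h5').mono
      (by omega) fun _ _ h => h) fun s6 hf6 ⟨κ', E, hloop, hG6, hκ6⟩ => ?_
    obtain ⟨hFE, hE, -⟩ := hloop.spec hδ hκ
    have hEs : IsSemicomplete E := ⟨fun i h => (hE i i h).1 rfl, fun i j hij =>
      (hF.total i j hij).imp (hFE i j) (hFE j i)⟩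
    refine (sccProg_runs hEs hpos ((hf6.nReg (by decide)).trans hn5) hG6).mono le_rfl
      fun s7 hf7 h7 => ⟨_, κ', ⟨h7.1, h7.2, fun i j => by rw [hf7.rArr (by decide), hκ6]⟩, C, E,
        sccLayering_isSCCListing hF hpos hF fun _ _ h => h, hloop,
        sccLayering_isSCCListing hEs hpos hF hFE⟩
  · have h1 : n ≤ n ^ 2 := Nat.le_self_pow (by norm_num) n
    have h2 : m ≤ m ^ 2 := Nat.le_self_pow (by norm_num) m
    have h3 : n * m ≤ n * m ^ 2 := Nat.mul_le_mul_left n h2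
    have h4 : m ≤ n * m := Nat.le_mul_of_pos_left m hpos
    have h5 : m ^ 2 ≤ n * m ^ 2 := Nat.le_mul_of_pos_left _ hpos
    have h6 : 1 ≤ n ^ 2 := hpos.trans_le h1
    nlinarith

end

end RealRAM

end

theorem mainTheorem5 :
    ∃ (P : RealRAM.Prog) (K : ℕ), ∀ (m n : ℕ) (A : Matrix (Fin m) (Fin n) ℝ)
      (β : ℝ) (δ : Fin n → ℝ) (κh : Fin n → Fin n → ℝ),
      0 < n → A.rank = m → 0 < β → β ≤ 1 / 4 → (∀ i, 0 < δ i) →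
      LayeredLS.IsEstimate (LayeredLS.kerSpace A) κh →
      -- every output of the subroutine is balanced
      (∀ (J : LayeredLS.Layering n) (κ' : Fin n → Fin n → ℝ),
        LayeredLS.LayeringReturns (LayeredLS.kerSpace A) β δ κh J κ' →
        LayeredLS.IsBalanced (LayeredLS.kerSpace A) β δ J) ∧
      -- the program carries out the subroutine within the claimed time
      ∃ (s : RealRAM.Store) (t : ℕ) (J : LayeredLS.Layering n) (κ' : Fin n → Fin n → ℝ),
        RealRAM.Exec P (RealRAM.inputStore A β δ κh) s t ∧
        t ≤ K * (n * m ^ 2 + n ^ 2) ∧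
        RealRAM.Holds s J κ' ∧
        LayeredLS.LayeringReturns (LayeredLS.kerSpace A) β δ κh J κ' ∧
        LayeredLS.IsBalanced (LayeredLS.kerSpace A) β δ J := by
  refine ⟨RealRAM.layeringProg, 3000, fun m n A β δ κh hn hA hβ hβ' hδ hκ => ?_⟩
  have hbal := fun J κ' h => LayeredLS.LayeringReturns.isBalanced (J := J) (κ' := κ') hn hβ hδ hκ h
  obtain ⟨s, t, hexec, ht, J, κ', hs, hret⟩ := RealRAM.layeringProg_runs hn hA hβ hβ' hδ hκ
  exact ⟨hbal, s, t, J, κ', hexec, ht, hs, hret, hbal J κ' hret⟩
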